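/- Let $K$ be a field of characteristic zero (for example $\mathbb C$). Let $E_{ij}$ ($i\ne j$) be the matrix units in $sl(4)=sl(4,K)$ and $H_{ij}=\tfrac12(E_{ii}-E_{jj})$. Equip $U=U(sl(4))$ with its standard bialgebra structure ($\Delta x=x\otimes 1+1\otimes x$, $\varepsilon(x)=0$ for $x\in sl(4)$), extended $h$-adically to $U[[h]]$. A *twist* of $U$ is an invertible $F\in (U\otimes U)[[h]]$ with $F\equiv 1 \pmod h$, $$F_{12}\,(\Delta\otimes \mathrm{id})(F)=F_{23}\,(\mathrm{id}\otimes\Delta)(F),\qquad (\varepsilon\otimes \mathrm{id})(F)=(\mathrm{id}\otimes\varepsilon)(F)=1 .$$ For a twist $F$ put $\Delta_F(x)=F\Delta(x)F^{-1}$, and let $U_F$ be $U[[h]]$ with the coproduct $\Delta_F$. A twist of $U_F$ is an invertible $G\in(U\otimes U)[[h]]$ that satisfies the same conditions with $\Delta_F$ in place of $\Delta$. An element $x\in U[[h]]$ is primitive in $U_F$ if $\Delta_F(x)=x\otimes 1+1\otimes x$. Let $\xi,\eta\in hK[[h]]$ be arbitrary deformation parameters (for example $\xi=\eta=h$), and put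 $$\sigma_{14}=\ln(1+\xi E_{14}),\qquad \Phi_{J_\perp}=\exp(H_{14}\otimes\sigma_{14}),$$ $$\Phi_{E}=\exp\big(\xi\,E_{12}\otimes E_{24}e^{-\frac12\sigma_{14}}\big),\qquad \Phi_{E'}=\exp\big(-\xi\,E_{34}\otimes E_{13}e^{-\frac12\sigma_{14}}\big),$$ $$E_B=-E_{23}+\xi\,E_{13}E_{24}e^{-\sigma_{14}},\qquad \sigma_B=\ln(1+\eta E_B),\qquad \Phi_{BJ}=\exp(H_{23}\otimes\sigma_B).$$ Then: 1. $F_{E'EJ}=\Phi_{E'}\Phi_{E}\Phi_{J_\perp}$ is a twist of $U(sl(4))$; 2. $E_B$ and $H_{23}$ are primitive in the twisted algebra $U_{F_{E'EJ}}$; 3. $[H_{23},E_B]=E_B$, and $H_{23},E_B$ are linearly independent over $K[[h]]$, so that they form a basis of a two-dimensional Borel subalgebra; 4. $\Phi_{BJ}$ is a twist of $U_{F_{E'EJ}}$; 5. $F_{BJE'EJ}=\Phi_{BJ}\Phi_{E'}\Phi_{E}\Phi_{J_\perp}$ is a twist of $U(sl(4))$. -/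

import Mathlib

open scoped TensorProduct PowerSeries

noncomputable section

/-! ### The universal enveloping algebra as a bialgebra -/

namespace UniversalEnvelopingAlgebra

attribute [local instance 100] LieRing.ofAssociativeRing

variable (R L : Type*) [CommRing R] [LieRing L] [LieAlgebra R L]

/-- The Lie algebra map `x ↦ x ⊗ 1 + 1 ⊗ x` from `L` to `U(L) ⊗ U(L)`. -/
def comulLie : L →ₗ⁅R⁆
    (UniversalEnvelopingAlgebra R L ⊗[R] UniversalEnvelopingAlgebra R L) where
  toFun x := ι R x ⊗ₜ 1 + 1 ⊗ₜ ι R x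
  map_add' x y := by
    simp only [map_add, TensorProduct.add_tmul, TensorProduct.tmul_add]; abel
  map_smul' r x := by
    simp only [map_smul, TensorProduct.smul_tmul', TensorProduct.tmul_smul, smul_add,
      RingHom.id_apply]
  map_lie' {x y} := by
    simp only [LieHom.map_lie, LieRing.of_associative_ring_bracket, add_mul, mul_add,
      Algebra.TensorProduct.tmul_mul_tmul, mul_one, one_mul, TensorProduct.sub_tmul,
      TensorProduct.tmul_sub]
    abel

/-- The standard coproduct of `U(L)`: elements of `L` are primitive. -/
def comulHom : UniversalEnvelopingAlgebra R L →ₐ[R]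
    (UniversalEnvelopingAlgebra R L ⊗[R] UniversalEnvelopingAlgebra R L) :=
  lift R (comulLie R L)

/-- The standard counit of `U(L)`: it vanishes on `L`. -/
def counitHom : UniversalEnvelopingAlgebra R L →ₐ[R] R :=
  lift R (0 : L →ₗ⁅R⁆ R)

theorem comulHom_ι (x : L) : comulHom R L (ι R x) = ι R x ⊗ₜ 1 + 1 ⊗ₜ ι R x :=
  lift_ι_apply R (comulLie R L) x

theorem counitHom_ι (x : L) : counitHom R L (ι R x) = 0 :=
  lift_ι_apply R (0 : L →ₗ⁅R⁆ R) x

theorem algHom_ext_ι {A : Type*} [Ring A] [Algebra R A]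
    {f g : UniversalEnvelopingAlgebra R L →ₐ[R] A} (h : ∀ x, f (ι R x) = g (ι R x)) : f = g :=
  hom_ext R (LieHom.ext h)

instance instBialgebra : Bialgebra R (UniversalEnvelopingAlgebra R L) :=
  Bialgebra.ofAlgHom (comulHom R L) (counitHom R L)
    (by
      refine algHom_ext_ι R L fun x => ?_
      simp [-ι_apply, comulHom_ι, TensorProduct.add_tmul, TensorProduct.tmul_add,
        Algebra.TensorProduct.one_def, add_assoc])
    (by
      refine algHom_ext_ι R L fun x => ?_
      simp [-ι_apply, comulHom_ι, counitHom_ι])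
    (by
      refine algHom_ext_ι R L fun x => ?_
      simp [-ι_apply, comulHom_ι, counitHom_ι])

end UniversalEnvelopingAlgebra

namespace JordanianTwist

/-! ### Formal power series with coefficients in an algebra

`A⟦X⟧` is the algebra of formal power series in a central deformation parameter `h = X`. The
`h`-adically completed tensor powers of `A⟦X⟧` are `(A ⊗ A)⟦X⟧` and `(A ⊗ (A ⊗ A))⟦X⟧`, and an algebra
homomorphism is extended to power series coefficientwise by `PowerSeries.map`. -/

section Formal

variable {K A : Type*} [Field K] [Ring A] [Algebra K A]

/-- The value `∑ₖ fₖ xᵏ` of a series `f` at an element `x` of `A⟦X⟧` with zero constant term: as `xᵏ`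
is divisible by `Xᵏ`, only the terms with `k ≤ n` contribute to the coefficient of `Xⁿ`. -/
def formalEval (f : K⟦X⟧) (x : A⟦X⟧) : A⟦X⟧ :=
  PowerSeries.mk fun n =>
    ∑ k ∈ Finset.range (n + 1), PowerSeries.coeff k f • PowerSeries.coeff n (x ^ k)

/-- `exp x`, for `x` with zero constant term. -/
def formalExp (K : Type*) {A : Type*} [Field K] [CharZero K] [Ring A] [Algebra K A]
    (x : A⟦X⟧) : A⟦X⟧ :=
  formalEval (PowerSeries.exp K) x

/-- `ln (1 + x)`, for `x` with zero constant term. -/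
def formalLogOneAdd (K : Type*) {A : Type*} [Field K] [CharZero K] [Ring A] [Algebra K A]
    (x : A⟦X⟧) : A⟦X⟧ :=
  formalEval (PowerSeries.log K) x

/-- The central element of `A⟦X⟧` given by a scalar series. -/
def scalar (A : Type*) [Ring A] [Algebra K A] (c : K⟦X⟧) : A⟦X⟧ :=
  PowerSeries.map (algebraMap K A) c

/-- `x ⊗ y ∈ (A ⊗ A)⟦X⟧` for `x, y ∈ A⟦X⟧`. -/
def tmul (K : Type*) {A : Type*} [Field K] [Ring A] [Algebra K A] (x y : A⟦X⟧) : (A ⊗[K] A)⟦X⟧ :=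
  PowerSeries.map (Algebra.TensorProduct.includeLeft : A →ₐ[K] A ⊗[K] A).toRingHom x *
    PowerSeries.map (Algebra.TensorProduct.includeRight : A →ₐ[K] A ⊗[K] A).toRingHom y

/-- `F ↦ F₁₂ = F ⊗ 1`. -/
def leg12 : (A ⊗[K] A)⟦X⟧ →+* (A ⊗[K] (A ⊗[K] A))⟦X⟧ :=
  PowerSeries.map (Algebra.TensorProduct.map (AlgHom.id K A)
    (Algebra.TensorProduct.includeLeft : A →ₐ[K] A ⊗[K] A)).toRingHom

/-- `F ↦ F₂₃ = 1 ⊗ F`. -/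
def leg23 : (A ⊗[K] A)⟦X⟧ →+* (A ⊗[K] (A ⊗[K] A))⟦X⟧ :=
  PowerSeries.map
    (Algebra.TensorProduct.includeRight : A ⊗[K] A →ₐ[K] A ⊗[K] (A ⊗[K] A)).toRingHom

/-- `H` and `E` are a basis over `K⟦X⟧` of a two-dimensional Borel subalgebra `[H, E] = E`. -/
structure IsBorelBasis (K : Type*) {A : Type*} [Field K] [Ring A] [Algebra K A]
    (H E : A⟦X⟧) : Prop where
  lie_eq : H * E - E * H = E
  linearIndependent : ∀ a b : K⟦X⟧, scalar A a * H + scalar A b * E = 0 → a = 0 ∧ b = 0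

end Formal

/-! ### Twists of a bialgebra -/

section Twist

variable {K A : Type*} [Field K] [Ring A] [Bialgebra K A]

/-- The coproduct of `A⟦X⟧`. -/
def comulₕ : A⟦X⟧ →+* (A ⊗[K] A)⟦X⟧ :=
  PowerSeries.map (Bialgebra.comulAlgHom K A).toRingHom

/-- `Δ ⊗ id` on `(A ⊗ A)⟦X⟧`. -/
def comulLeft : (A ⊗[K] A)⟦X⟧ →+* (A ⊗[K] (A ⊗[K] A))⟦X⟧ :=
  PowerSeries.map ((Algebra.TensorProduct.assoc K K K A A A).toAlgHom.comp
    (Algebra.TensorProduct.map (Bialgebra.comulAlgHom K A) (AlgHom.id K A))).toRingHom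

/-- `id ⊗ Δ` on `(A ⊗ A)⟦X⟧`. -/
def comulRight : (A ⊗[K] A)⟦X⟧ →+* (A ⊗[K] (A ⊗[K] A))⟦X⟧ :=
  PowerSeries.map
    (Algebra.TensorProduct.map (AlgHom.id K A) (Bialgebra.comulAlgHom K A)).toRingHom

/-- `ε ⊗ id` on `(A ⊗ A)⟦X⟧`. -/
def counitLeft : (A ⊗[K] A)⟦X⟧ →+* A⟦X⟧ :=
  PowerSeries.map ((Algebra.TensorProduct.lid K A).toAlgHom.comp
    (Algebra.TensorProduct.map (Bialgebra.counitAlgHom K A) (AlgHom.id K A))).toRingHom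

/-- `id ⊗ ε` on `(A ⊗ A)⟦X⟧`. -/
def counitRight : (A ⊗[K] A)⟦X⟧ →+* A⟦X⟧ :=
  PowerSeries.map ((Algebra.TensorProduct.rid K K A).toAlgHom.comp
    (Algebra.TensorProduct.map (AlgHom.id K A) (Bialgebra.counitAlgHom K A))).toRingHom

/-- The twisted coproduct `Δ_F(x) = F Δ(x) F⁻¹`. -/
def twistedComul (F : (A ⊗[K] A)⟦X⟧) (x : A⟦X⟧) : (A ⊗[K] A)⟦X⟧ :=
  F * comulₕ x * Ring.inverse F

/-- `Δ_F ⊗ id`, which is `Y ↦ F₁₂ (Δ ⊗ id)(Y) F₁₂⁻¹`. -/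
def twistedComulLeft (F Y : (A ⊗[K] A)⟦X⟧) : (A ⊗[K] (A ⊗[K] A))⟦X⟧ :=
  leg12 F * comulLeft Y * Ring.inverse (leg12 F)

/-- `id ⊗ Δ_F`, which is `Y ↦ F₂₃ (id ⊗ Δ)(Y) F₂₃⁻¹`. -/
def twistedComulRight (F Y : (A ⊗[K] A)⟦X⟧) : (A ⊗[K] (A ⊗[K] A))⟦X⟧ :=
  leg23 F * comulRight Y * Ring.inverse (leg23 F)

/-- `F = 1 + O(h)` is an invertible solution of the twist equation
`F₁₂ (Δ ⊗ id)(F) = F₂₃ (id ⊗ Δ)(F)` with `(ε ⊗ id)(F) = (id ⊗ ε)(F) = 1`. -/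
structure IsTwist (F : (A ⊗[K] A)⟦X⟧) : Prop where
  isUnit : IsUnit F
  constantCoeff_eq : PowerSeries.constantCoeff F = 1
  cocycle : leg12 F * comulLeft F = leg23 F * comulRight F
  counit_left : counitLeft F = 1
  counit_right : counitRight F = 1

/-- `G` is a twist of the bialgebra `A⟦X⟧` with coproduct `Δ_F` (for a twist `F` of `A`). -/
structure IsTwistOfTwisted (F G : (A ⊗[K] A)⟦X⟧) : Prop where
  isUnit : IsUnit G
  constantCoeff_eq : PowerSeries.constantCoeff G = 1
  cocycle : leg12 G * twistedComulLeft F G = leg23 G * twistedComulRight F G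
  counit_left : counitLeft G = 1
  counit_right : counitRight G = 1

/-- `x` is primitive for the twisted coproduct: `Δ_F(x) = x ⊗ 1 + 1 ⊗ x`. -/
def IsPrimitiveFor (F : (A ⊗[K] A)⟦X⟧) (x : A⟦X⟧) : Prop :=
  twistedComul F x = tmul K x 1 + tmul K 1 x

end Twist

/-! ### The twists of `U(sl(4))` -/

section SL4

open LieAlgebra.SpecialLinear

variable (K : Type*) [Field K]

/-- The universal enveloping algebra of `sl(4)` over `K`. -/
abbrev USL4 : Type _ := UniversalEnvelopingAlgebra K (sl (Fin 4) K)

variable {K}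

/-- The matrix unit `E_{i+1,j+1}` (indices in `Fin 4` start at `0`), as a constant series. -/
def E (K : Type*) [Field K] (i j : Fin 4) (h : i ≠ j := by decide) : (USL4 K)⟦X⟧ :=
  PowerSeries.C (UniversalEnvelopingAlgebra.ι K (single i j h (1 : K)))

/-- The Cartan element `H_{i+1,j+1} = ½ (E_{i+1,i+1} - E_{j+1,j+1})`, as a constant series. -/
def H (K : Type*) [Field K] (i j : Fin 4) : (USL4 K)⟦X⟧ :=
  PowerSeries.C (UniversalEnvelopingAlgebra.ι K (singleSubSingle i j (1 / 2 : K)))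

variable [CharZero K]

/-- `σ₁₄ = ln (1 + ξ E₁₄)`. -/
def σ₁₄ (ξ : K⟦X⟧) : (USL4 K)⟦X⟧ :=
  formalLogOneAdd K (scalar _ ξ * E K 0 3)

/-- `Φ_J = exp (H₁₄ ⊗ σ₁₄)`. -/
def ΦJ (ξ : K⟦X⟧) : (USL4 K ⊗[K] USL4 K)⟦X⟧ :=
  formalExp K (tmul K (H K 0 3) (σ₁₄ ξ))

/-- `Φ_E = exp (ξ E₁₂ ⊗ E₂₄ e^{-σ₁₄/2})`. -/
def ΦE (ξ : K⟦X⟧) : (USL4 K ⊗[K] USL4 K)⟦X⟧ :=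
  formalExp K (scalar _ ξ * tmul K (E K 0 1) (E K 1 3 * formalExp K ((-1 / 2 : K) • σ₁₄ ξ)))

/-- `Φ_{E'} = exp (-ξ E₃₄ ⊗ E₁₃ e^{-σ₁₄/2})`. -/
def ΦE' (ξ : K⟦X⟧) : (USL4 K ⊗[K] USL4 K)⟦X⟧ :=
  formalExp K (-(scalar _ ξ * tmul K (E K 2 3) (E K 0 2 * formalExp K ((-1 / 2 : K) • σ₁₄ ξ))))

/-- `E_B = -E₂₃ + ξ E₁₃ E₂₄ e^{-σ₁₄}`. -/
def EB (ξ : K⟦X⟧) : (USL4 K)⟦X⟧ :=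
  -E K 1 2 + scalar _ ξ * (E K 0 2 * E K 1 3 * formalExp K (-σ₁₄ ξ))

/-- `σ_B = ln (1 + η E_B)`. -/
def σB (ξ η : K⟦X⟧) : (USL4 K)⟦X⟧ :=
  formalLogOneAdd K (scalar _ η * EB ξ)

/-- `Φ_{BJ} = exp (H₂₃ ⊗ σ_B)`. -/
def ΦBJ (ξ η : K⟦X⟧) : (USL4 K ⊗[K] USL4 K)⟦X⟧ :=
  formalExp K (tmul K (H K 1 2) (σB ξ η))

end SL4

end JordanianTwist

end

open JordanianTwist

/-! Two general constructions produce every factor, and composition assembles them. If `F` is a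
twist of `A` and `G` is a twist of the twisted bialgebra, then `G * F` is a twist of `A`
(`IsTwistOfTwisted.isTwist_mul`). The first construction (`isTwistOfTwisted_jordanian`) takes
primitive `h`, `e` with `[h, e] = e` and gives `exp(h ⊗ ln(1 + e))`. It is used twice: for `H₁₄,
ξE₁₄` over the trivial twist, and for `H₂₃, ηE_B` over the extended twist. The second
(`isTwistOfTwisted_extension`) gives `exp(a ⊗ b)` when the coproducts are `a ⊗ k + 1 ⊗ a` and `b ⊗ 1
+ k' ⊗ b` and `[a, b] = k - k'`. After the first Jordanian twist, with `k = e^{σ/2}` and `k' =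
e^{-σ/2}`, the pairs `(ξE₁₂, E₂₄e^{-σ/2})` and `(-ξE₃₄, E₁₃e^{-σ/2})` both qualify, because `ξE₁₄ =
e^σ - 1`. The two pairs commute with each other, so using the first leaves the coproducts of the
second unchanged.

What remains is the primitivity of `E_B` and `H₂₃`. The extension factors are invariant under `H₂₃ ⊗
1 + 1 ⊗ H₂₃` since their legs have opposite weights. Twisting `Δ(E₂₃)` creates three extra terms,
and these are exactly the nonprimitive part of the twisted coproduct of `ξE₁₃E₂₄e^{-σ}`
(`semiconjBy_comulₕ_EB`). Linear independence is read off in the defining representation, where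
`E₁₃E₂₄` acts by zero.

Conjugations are written as `SemiconjBy F x y`, that is `F x = y F`: this is stable under sums,
products and `formalEval`, and needs no inverses. -/

noncomputable section

namespace JordanianTwist

/-! ### Evaluating scalar power series at noncommutative series without constant term. -/

section FormalCalculus

variable {K A B : Type*} [Field K] [Ring A] [Algebra K A] [Ring B] [Algebra K B]

theorem coeff_pow_eq_zero {x : A⟦X⟧} (hx : PowerSeries.constantCoeff x = 0) {n k : ℕ}
    (h : n < k) : PowerSeries.coeff n (x ^ k) = 0 := by
  obtain ⟨y, rfl⟩ := PowerSeries.X_dvd_iff.mpr hx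
  rw [((PowerSeries.commute_X y).symm).mul_pow, PowerSeries.coeff_X_pow_mul', if_neg (by omega)]

theorem coeff_pow_mul_pow_eq_zero {x y : A⟦X⟧} (hx : PowerSeries.constantCoeff x = 0)
    (hy : PowerSeries.constantCoeff y = 0) {n j k : ℕ} (h : n < j + k) :
    PowerSeries.coeff n (x ^ j * y ^ k) = 0 := by
  rw [PowerSeries.coeff_mul]
  refine Finset.sum_eq_zero fun p hp => ?_
  have := Finset.HasAntidiagonal.mem_antidiagonal.mp hp
  rcases lt_or_ge p.1 j with h1 | h1
  · rw [coeff_pow_eq_zero hx h1, zero_mul]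
  · rw [coeff_pow_eq_zero hy (by omega), mul_zero]

/-- The truncation `∑_{k < N} fₖ xᵏ` of `formalEval f x`. -/
def truncEval (f : K⟦X⟧) (N : ℕ) (x : A⟦X⟧) : A⟦X⟧ :=
  ∑ k ∈ Finset.range N, PowerSeries.coeff k f • x ^ k

theorem coeff_truncEval (f : K⟦X⟧) (N : ℕ) (x : A⟦X⟧) (n : ℕ) :
    PowerSeries.coeff n (truncEval f N x) =
      ∑ k ∈ Finset.range N, PowerSeries.coeff k f • PowerSeries.coeff n (x ^ k) := by
  simp [truncEval, map_sum]

/-- Any sufficiently long truncation computes a given coefficient, so identities for `formalEval`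
reduce to identities of polynomials in `x`, with no topology involved. -/
theorem coeff_formalEval (f : K⟦X⟧) {x : A⟦X⟧} (hx : PowerSeries.constantCoeff x = 0) {n N : ℕ}
    (h : n < N) :
    PowerSeries.coeff n (formalEval f x) = PowerSeries.coeff n (truncEval f N x) := by
  rw [formalEval, PowerSeries.coeff_mk, coeff_truncEval]
  refine Finset.sum_subset (Finset.range_subset_range.mpr h) fun k _ hk => ?_
  rw [coeff_pow_eq_zero hx (by simpa using hk), smul_zero]

theorem coeff_mul_congr {a a' b b' : A⟦X⟧} {n : ℕ}
    (ha : ∀ i ≤ n, PowerSeries.coeff i a = PowerSeries.coeff i a')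
    (hb : ∀ i ≤ n, PowerSeries.coeff i b = PowerSeries.coeff i b') :
    PowerSeries.coeff n (a * b) = PowerSeries.coeff n (a' * b') := by
  rw [PowerSeries.coeff_mul, PowerSeries.coeff_mul]
  refine Finset.sum_congr rfl fun p hp => ?_
  have := Finset.HasAntidiagonal.mem_antidiagonal.mp hp
  rw [ha _ (by omega), hb _ (by omega)]

/-- The triangle `j + k < N` may be enlarged to the full square because the added terms vanish; this
compares a Cauchy product with a product of truncations. -/
theorem sum_antidiagonal_eq_sum_range {M : Type*} [AddCommMonoid M] {N : ℕ} {T : ℕ → ℕ → M}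
    (hT : ∀ j k, N ≤ j + k → T j k = 0) :
    ∑ m ∈ Finset.range N, ∑ p ∈ Finset.HasAntidiagonal.antidiagonal m, T p.1 p.2 =
      ∑ j ∈ Finset.range N, ∑ k ∈ Finset.range N, T j k := by
  simp_rw [Finset.Nat.sum_antidiagonal_eq_sum_range_succ T]
  rw [Finset.sum_range_diag_flip]
  refine Finset.sum_congr rfl fun j _ => ?_
  refine Finset.sum_subset (Finset.range_subset_range.mpr (Nat.sub_le _ _)) fun k _ hk => hT _ _ ?_
  have : ¬ k < N - j := by simpa using hk
  omega

theorem formalEval_add (f g : K⟦X⟧) (x : A⟦X⟧) :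
    formalEval (f + g) x = formalEval f x + formalEval g x := by
  ext n
  simp [formalEval, add_smul, Finset.sum_add_distrib]

theorem formalEval_sub (f g : K⟦X⟧) (x : A⟦X⟧) :
    formalEval (f - g) x = formalEval f x - formalEval g x := by
  ext n
  simp [formalEval, sub_smul, Finset.sum_sub_distrib]

theorem formalEval_one (x : A⟦X⟧) : formalEval (1 : K⟦X⟧) x = 1 := by
  ext n
  rw [formalEval, PowerSeries.coeff_mk, Finset.sum_eq_single 0]
  · simp
  · intro k _ hk
    simp [PowerSeries.coeff_one, hk]
  · simp

theorem formalEval_X {x : A⟦X⟧} (hx : PowerSeries.constantCoeff x = 0) :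
    formalEval (PowerSeries.X : K⟦X⟧) x = x := by
  ext n
  -- Length `n + 2` rather than `n + 1`, so that the index `1` is in range even for `n = 0`.
  rw [coeff_formalEval _ hx (show n < n + 2 by omega), coeff_truncEval, Finset.sum_eq_single 1]
  · simp
  · intro k _ hk
    simp [PowerSeries.coeff_X, hk]
  · simp

theorem constantCoeff_formalEval (f : K⟦X⟧) (x : A⟦X⟧) :
    PowerSeries.constantCoeff (formalEval f x) = PowerSeries.constantCoeff f • (1 : A) := by
  rw [← PowerSeries.coeff_zero_eq_constantCoeff_apply, formalEval, PowerSeries.coeff_mk]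
  simp

theorem map_formalEval (φ : A →ₐ[K] B) (f : K⟦X⟧) (x : A⟦X⟧) :
    PowerSeries.map φ.toRingHom (formalEval f x) =
      formalEval f (PowerSeries.map φ.toRingHom x) := by
  ext n
  simp [formalEval, map_sum, ← map_pow]

theorem truncEval_mul_semiconjBy (f : K⟦X⟧) (N : ℕ) {x x' y : A⟦X⟧} (h : SemiconjBy y x x') :
    SemiconjBy y (truncEval f N x) (truncEval f N x') := by
  simp only [SemiconjBy, truncEval, Finset.mul_sum, Finset.sum_mul, mul_smul_comm, smul_mul_assoc,
    (h.pow_right _).eq]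

/-- The workhorse: conjugation passes through exponentials and logarithms, so it only has to be
computed on their arguments. -/
theorem formalEval_semiconjBy (f : K⟦X⟧) {x x' y : A⟦X⟧} (hx : PowerSeries.constantCoeff x = 0)
    (hx' : PowerSeries.constantCoeff x' = 0) (h : SemiconjBy y x x') :
    SemiconjBy y (formalEval f x) (formalEval f x') := by
  ext n
  rw [coeff_mul_congr (a' := y) (b' := truncEval f (n + 1) x) (fun _ _ => rfl)
      fun i hi => coeff_formalEval f hx (by omega),
    coeff_mul_congr (a' := truncEval f (n + 1) x') (b' := y)
      (fun i hi => coeff_formalEval f hx' (by omega)) fun _ _ => rfl,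
    (truncEval_mul_semiconjBy f (n + 1) h).eq]

theorem formalEval_commute (f : K⟦X⟧) {x y : A⟦X⟧} (hx : PowerSeries.constantCoeff x = 0)
    (h : Commute y x) : Commute y (formalEval f x) :=
  formalEval_semiconjBy f hx hx h

theorem coeff_formalEval_mul_formalEval (f g : K⟦X⟧) {x y : A⟦X⟧}
    (hx : PowerSeries.constantCoeff x = 0) (hy : PowerSeries.constantCoeff y = 0) (n : ℕ) :
    PowerSeries.coeff n (formalEval f x * formalEval g y) =
      ∑ m ∈ Finset.range (n + 1), ∑ p ∈ Finset.HasAntidiagonal.antidiagonal m,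
        (PowerSeries.coeff p.1 f * PowerSeries.coeff p.2 g) •
          PowerSeries.coeff n (x ^ p.1 * y ^ p.2) := by
  rw [sum_antidiagonal_eq_sum_range (N := n + 1) (T := fun j k =>
      (PowerSeries.coeff j f * PowerSeries.coeff k g) • PowerSeries.coeff n (x ^ j * y ^ k))
      fun j k h => by rw [coeff_pow_mul_pow_eq_zero hx hy (by omega), smul_zero],
    coeff_mul_congr (a' := truncEval f (n + 1) x) (b' := truncEval g (n + 1) y)
      (fun i hi => coeff_formalEval f hx (by omega)) fun i hi => coeff_formalEval g hy (by omega)]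
  simp only [truncEval, Finset.sum_mul, Finset.mul_sum, map_sum]
  rw [Finset.sum_comm]
  simp only [smul_mul_smul_comm, PowerSeries.coeff_smul]

theorem formalEval_mul (f g : K⟦X⟧) {x : A⟦X⟧} (hx : PowerSeries.constantCoeff x = 0) :
    formalEval (f * g) x = formalEval f x * formalEval g x := by
  ext n
  rw [coeff_formalEval_mul_formalEval f g hx hx, formalEval, PowerSeries.coeff_mk]
  refine Finset.sum_congr rfl fun m _ => ?_
  rw [PowerSeries.coeff_mul, Finset.sum_smul]
  refine Finset.sum_congr rfl fun p hp => ?_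
  rw [← pow_add, Finset.HasAntidiagonal.mem_antidiagonal.mp hp]

theorem formalEval_pow (f : K⟦X⟧) {x : A⟦X⟧} (hx : PowerSeries.constantCoeff x = 0) (k : ℕ) :
    formalEval (f ^ k) x = formalEval f x ^ k := by
  induction k with
  | zero => simp [formalEval_one]
  | succ k ih => rw [pow_succ, pow_succ, formalEval_mul _ _ hx, ih]

/-- Only powers of the single element `x` occur, so identities between `exp` and `log` proved in the
commutative ring `K⟦X⟧` transfer to `A⟦X⟧`. -/
theorem formalEval_formalEval (f : K⟦X⟧) {g : K⟦X⟧} (hg : PowerSeries.constantCoeff g = 0)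
    {x : A⟦X⟧} (hx : PowerSeries.constantCoeff x = 0) :
    formalEval f (formalEval g x) = formalEval (formalEval f g) x := by
  ext n
  simp only [formalEval, PowerSeries.coeff_mk]
  have h1 : ∀ k ∈ Finset.range (n + 1),
      (∑ j ∈ Finset.range (k + 1), PowerSeries.coeff j f • PowerSeries.coeff k (g ^ j)) •
        PowerSeries.coeff n (x ^ k) =
      ∑ j ∈ Finset.range (n + 1), PowerSeries.coeff j f •
        PowerSeries.coeff k (g ^ j) • PowerSeries.coeff n (x ^ k) := by
    intro k hk
    rw [Finset.sum_smul]
    simp only [smul_assoc]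
    refine Finset.sum_subset (Finset.range_subset_range.mpr (by simpa using hk)) fun j _ hj => ?_
    rw [coeff_pow_eq_zero hg (by simpa using hj), zero_smul, smul_zero]
  rw [Finset.sum_congr rfl h1, Finset.sum_comm]
  refine Finset.sum_congr rfl fun j _ => ?_
  rw [← Finset.smul_sum]
  change _ • PowerSeries.coeff n (formalEval g x ^ j) = _
  rw [← formalEval_pow g hx, formalEval, PowerSeries.coeff_mk]

theorem formalEval_eq_subst (f : K⟦X⟧) {g : K⟦X⟧} (hg : PowerSeries.constantCoeff g = 0) :
    formalEval f g = f.subst g := by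
  ext n
  rw [PowerSeries.coeff_subst' (PowerSeries.HasSubst.of_constantCoeff_zero' hg),
    finsum_eq_sum_of_support_subset (s := Finset.range (n + 1)), formalEval, PowerSeries.coeff_mk]
  intro k hk
  by_contra h
  exact hk (by
    change _ • _ = _
    rw [coeff_pow_eq_zero hg (by simpa using h), smul_zero])

end FormalCalculus

/-! ### Exponential, logarithm, and their commutation relations. -/

section ExpLog

variable {K A B : Type*} [Field K] [CharZero K] [Ring A] [Algebra K A] [Ring B] [Algebra K B]

theorem derivative_log_mul_one_add_X :
    PowerSeries.derivative K (PowerSeries.log K) * (1 + PowerSeries.X) = 1 := by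
  rw [PowerSeries.deriv_log, mul_add, mul_one]
  ext n
  cases n with
  | zero => simp
  | succ n => simp [PowerSeries.coeff_succ_mul_X, pow_succ, PowerSeries.coeff_one]

/-- Both sides have derivative `1`, by the chain rule and `log' · (1 + X) = 1`, and constant term
`0`. -/
theorem log_subst_exp_sub_one :
    (PowerSeries.log K).subst (PowerSeries.exp K - 1) = PowerSeries.X := by
  have hs := PowerSeries.HasSubst.exp_sub_one (A := K)
  refine PowerSeries.derivative.ext ?_ ?_
  · rw [PowerSeries.derivative_subst hs]
    have := congrArg (PowerSeries.subst (PowerSeries.exp K - 1))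
      (derivative_log_mul_one_add_X (K := K))
    rw [← PowerSeries.coe_substAlgHom hs] at this ⊢
    simp only [map_mul, map_add, map_one] at this
    rw [PowerSeries.coe_substAlgHom hs, PowerSeries.subst_X hs] at this
    simpa [PowerSeries.coe_substAlgHom hs, PowerSeries.derivative_exp] using this
  · rw [← formalEval_eq_subst _ (by simp), constantCoeff_formalEval]
    simp

/-- With `Y = exp ∘ log` and `G = log'`, one has `Y' = YG` and `G' = -G²`, so `YG` has zero
derivative and equals its constant term `1`. Since `G` is inverse to `1 + X`, this determines `Y`.
-/
theorem exp_subst_log :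
    (PowerSeries.exp K).subst (PowerSeries.log K) = 1 + PowerSeries.X := by
  have hs := PowerSeries.HasSubst.log (A := K)
  set Y := (PowerSeries.exp K).subst (PowerSeries.log K) with hY
  set G := PowerSeries.derivative K (PowerSeries.log K) with hG
  have hG1 : G * (1 + PowerSeries.X) = 1 := derivative_log_mul_one_add_X
  have hdY : PowerSeries.derivative K Y = Y * G := by
    rw [hY, PowerSeries.derivative_subst hs, PowerSeries.derivative_exp]
  have hdG : PowerSeries.derivative K G = -(G * G) := by
    have := congrArg (PowerSeries.derivative K) hG1
    simp at this
    linear_combination G * this - PowerSeries.derivative K G * hG1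
  have hYG : Y * G = 1 := by
    refine PowerSeries.derivative.ext ?_ ?_
    · rw [Derivation.leibniz, hdY, hdG]
      simp
      ring
    · rw [hY, ← formalEval_eq_subst _ (by simp), map_mul, constantCoeff_formalEval, hG,
        PowerSeries.deriv_log]
      simp
  linear_combination (1 + PowerSeries.X) * hYG - Y * hG1

theorem constantCoeff_formalExp (x : A⟦X⟧) :
    PowerSeries.constantCoeff (formalExp K x) = 1 := by
  simp [formalExp, constantCoeff_formalEval]

theorem constantCoeff_formalLogOneAdd (x : A⟦X⟧) :
    PowerSeries.constantCoeff (formalLogOneAdd K x) = 0 := by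
  simp [formalLogOneAdd, constantCoeff_formalEval]

theorem formalExp_formalLogOneAdd {x : A⟦X⟧} (hx : PowerSeries.constantCoeff x = 0) :
    formalExp K (formalLogOneAdd K x) = 1 + x := by
  rw [formalExp, formalLogOneAdd, formalEval_formalEval _ (by simp) hx,
    formalEval_eq_subst _ (by simp), exp_subst_log, formalEval_add, formalEval_one, formalEval_X hx]

theorem formalLogOneAdd_formalExp_sub_one {x : A⟦X⟧} (hx : PowerSeries.constantCoeff x = 0) :
    formalLogOneAdd K (formalExp K x - 1) = x := by
  rw [formalExp, formalLogOneAdd, ← formalEval_one (K := K) x, ← formalEval_sub,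
    formalEval_formalEval _ (by simp) hx,
    formalEval_eq_subst _ (by simp), log_subst_exp_sub_one, formalEval_X hx]

theorem formalExp_add {x y : A⟦X⟧} (hx : PowerSeries.constantCoeff x = 0)
    (hy : PowerSeries.constantCoeff y = 0) (h : Commute x y) :
    formalExp K (x + y) = formalExp K x * formalExp K y := by
  ext n
  rw [formalExp, formalExp, formalExp, coeff_formalEval_mul_formalEval _ _ hx hy, formalEval,
    PowerSeries.coeff_mk]
  refine Finset.sum_congr rfl fun m _ => ?_
  rw [h.add_pow', map_sum, Finset.smul_sum]
  refine Finset.sum_congr rfl fun p hp => ?_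
  have hm := Finset.HasAntidiagonal.mem_antidiagonal.mp hp
  rw [map_nsmul, ← Nat.cast_smul_eq_nsmul K, smul_smul]
  congr 1
  subst hm
  have h1 := Nat.add_choose_mul_factorial_mul_factorial p.1 p.2
  rw [← Nat.choose_symm_add] at h1
  have h2 : ((p.1 + p.2).choose p.1 : K) * p.1.factorial * p.2.factorial =
    (p.1 + p.2).factorial := by exact_mod_cast h1
  have n1 : (p.1.factorial : K) ≠ 0 := by exact_mod_cast p.1.factorial_ne_zero
  have n2 : (p.2.factorial : K) ≠ 0 := by exact_mod_cast p.2.factorial_ne_zero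
  have n3 : ((p.1 + p.2).factorial : K) ≠ 0 := by exact_mod_cast (p.1 + p.2).factorial_ne_zero
  simp only [PowerSeries.coeff_exp, map_div₀, map_one, map_natCast]
  field_simp
  linear_combination h2

theorem formalExp_zero : formalExp K (0 : A⟦X⟧) = 1 := by
  ext n
  rw [formalExp, formalEval, PowerSeries.coeff_mk, Finset.sum_eq_single 0]
  · simp
  · intro k _ hk
    simp [hk]
  · simp

theorem formalLogOneAdd_zero : formalLogOneAdd K (0 : A⟦X⟧) = 0 := by
  simpa [formalExp_zero] using formalLogOneAdd_formalExp_sub_one (K := K)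
    (x := (0 : A⟦X⟧)) (by simp)

theorem formalExp_mul_formalExp_neg {x : A⟦X⟧} (hx : PowerSeries.constantCoeff x = 0) :
    formalExp K x * formalExp K (-x) = 1 := by
  rw [← formalExp_add hx (by simp [hx]) (Commute.refl x).neg_right, add_neg_cancel, formalExp_zero]

theorem formalExp_neg_mul_formalExp {x : A⟦X⟧} (hx : PowerSeries.constantCoeff x = 0) :
    formalExp K (-x) * formalExp K x = 1 := by
  rw [← formalExp_add (by simp [hx]) hx (Commute.refl x).neg_left, neg_add_cancel, formalExp_zero]

theorem isUnit_formalExp {x : A⟦X⟧} (hx : PowerSeries.constantCoeff x = 0) :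
    IsUnit (formalExp K x) :=
  ⟨⟨_, _, formalExp_mul_formalExp_neg hx, formalExp_neg_mul_formalExp hx⟩, rfl⟩

theorem map_formalExp (φ : A →ₐ[K] B) (x : A⟦X⟧) :
    PowerSeries.map φ.toRingHom (formalExp K x) = formalExp K (PowerSeries.map φ.toRingHom x) :=
  map_formalEval φ _ x

theorem map_formalLogOneAdd (φ : A →ₐ[K] B) (x : A⟦X⟧) :
    PowerSeries.map φ.toRingHom (formalLogOneAdd K x) =
      formalLogOneAdd K (PowerSeries.map φ.toRingHom x) :=
  map_formalEval φ _ x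

/-- Exponentiate the right side: it becomes `(1 + x)(1 + y)`, and `ln(exp z) = z` brings it back. -/
theorem formalLogOneAdd_add_formalLogOneAdd {x y : A⟦X⟧}
    (hx : PowerSeries.constantCoeff x = 0) (hy : PowerSeries.constantCoeff y = 0)
    (h : Commute x y) :
    formalLogOneAdd K (x + y + x * y) = formalLogOneAdd K x + formalLogOneAdd K y := by
  have hc : Commute (formalLogOneAdd K x) (formalLogOneAdd K y) :=
    formalEval_commute _ hy (formalEval_commute _ hx h.symm).symm
  have hlx := constantCoeff_formalLogOneAdd (K := K) x
  have hly := constantCoeff_formalLogOneAdd (K := K) y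
  rw [← formalLogOneAdd_formalExp_sub_one (K := K)
      (x := formalLogOneAdd K x + formalLogOneAdd K y) (by rw [map_add, hlx, hly, add_zero]),
    formalExp_add hlx hly hc, formalExp_formalLogOneAdd hx, formalExp_formalLogOneAdd hy]
  congr 1
  noncomm_ring

theorem pow_mul_of_mul_eq_add {R : Type*} [Ring R] {x y c : R} (h : x * y = y * x + c)
    (hc : Commute x c) (k : ℕ) :
    x ^ (k + 1) * y = y * x ^ (k + 1) + (k + 1 : ℕ) • (c * x ^ k) := by
  induction k with
  | zero => simpa using h
  | succ k ih =>
    rw [pow_succ', mul_assoc, ih, mul_add, ← mul_assoc, h, mul_smul_comm, ← mul_assoc, hc.eq,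
      mul_assoc c, ← pow_succ', add_mul, mul_assoc y, ← pow_succ', add_assoc, succ_nsmul _ (k + 1),
      add_comm (c * _)]

/-- Since `[x, y] = c` commutes with `x`, the series `exp(ad x) y` stops after its linear term. -/
theorem formalExp_semiconjBy_add {x y c : A⟦X⟧} (hx : PowerSeries.constantCoeff x = 0)
    (h : x * y = y * x + c) (hc : Commute x c) :
    SemiconjBy (formalExp K x) y (y + c) := by
  -- Commuting `xᵏ⁺¹` past `y` yields `(k + 1) c xᵏ`, and `(k + 1)/(k + 1)! = 1/k!`, so the
  -- correction is the exponential truncated one term earlier.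
  have key : ∀ N, truncEval (PowerSeries.exp K) (N + 1) x * y =
      y * truncEval (PowerSeries.exp K) (N + 1) x + c * truncEval (PowerSeries.exp K) N x := by
    intro N
    simp only [truncEval]
    rw [Finset.sum_range_succ', add_mul, mul_add, Finset.sum_mul, Finset.mul_sum, Finset.mul_sum,
      add_right_comm, ← Finset.sum_add_distrib]
    congr 1
    · refine Finset.sum_congr rfl fun k _ => ?_
      rw [smul_mul_assoc, pow_mul_of_mul_eq_add h hc, mul_smul_comm, mul_smul_comm, smul_add]
      congr 1
      rw [← Nat.cast_smul_eq_nsmul K, smul_smul]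
      congr 1
      have n1 : (k.factorial : K) ≠ 0 := by exact_mod_cast k.factorial_ne_zero
      have n2 : ((k : K) + 1) ≠ 0 := by exact_mod_cast k.succ_ne_zero
      simp only [PowerSeries.coeff_exp, map_div₀, map_one, map_natCast, Nat.factorial_succ,
        Nat.cast_mul, Nat.cast_add, Nat.cast_one]
      push_cast
      field_simp
    · simp
  have hcomm : Commute c (formalExp K x) := formalEval_commute _ hx hc.symm
  rw [SemiconjBy, add_mul]
  ext n
  -- Truncating at `n + 2` leaves `n + 1` terms beside `c`, still enough for the coefficient of
  -- index `n`.
  rw [formalExp, map_add, coeff_mul_congr (a' := truncEval _ (n + 1 + 1) x) (b' := y)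
      (fun i hi => coeff_formalEval _ hx (by omega)) fun _ _ => rfl,
    coeff_mul_congr (a := y) (a' := y) (b' := truncEval _ (n + 1 + 1) x) (fun _ _ => rfl)
      (fun i hi => coeff_formalEval _ hx (by omega)),
    coeff_mul_congr (a := c) (a' := c) (b' := truncEval _ (n + 1) x) (fun _ _ => rfl)
      (fun i hi => coeff_formalEval _ hx (by omega)), key, map_add]

/-- `x y = y (x + z)` with `z` commuting with `x` gives `exp(x) y = y exp(z) exp(x)`. -/
theorem formalExp_mul_of_semiconjBy {x y z : A⟦X⟧} (hx : PowerSeries.constantCoeff x = 0)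
    (hz : PowerSeries.constantCoeff z = 0) (h : x * y = y * (z + x)) (hc : Commute z x) :
    formalExp K x * y = y * formalExp K z * formalExp K x := by
  rw [mul_assoc, ← formalExp_add hz hx hc]
  exact (formalEval_semiconjBy (PowerSeries.exp K) (by simp [hx, hz]) hx
    (show SemiconjBy y (z + x) x from h.symm)).eq.symm

/-- `exp(x) exp(y) = exp(y) exp(c) exp(x)` if `c = [x, y]` commutes with `x` and `y`. -/
theorem formalExp_mul_formalExp_of_central {x y c : A⟦X⟧}
    (hx : PowerSeries.constantCoeff x = 0) (hy : PowerSeries.constantCoeff y = 0)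
    (hc : PowerSeries.constantCoeff c = 0)
    (h : x * y = y * x + c) (hxc : Commute x c) (hyc : Commute y c) :
    formalExp K x * formalExp K y = formalExp K y * formalExp K c * formalExp K x := by
  rw [← formalExp_add hy hc hyc]
  exact (formalEval_semiconjBy (PowerSeries.exp K) hy (by simp [hy, hc])
    (formalExp_semiconjBy_add (K := K) hx h hxc)).eq

end ExpLog

/-! ### Tensor legs: embeddings into two and three factors. -/

section Legs

variable {K A : Type*} [Field K] [Ring A] [Algebra K A]

theorem commute_map {R S T : Type*} [Semiring R] [Semiring S] [Semiring T] (f : R →+* T)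
    (g : S →+* T) (h : ∀ r s, Commute (f r) (g s)) (x : R⟦X⟧) (y : S⟦X⟧) :
    Commute (PowerSeries.map f x) (PowerSeries.map g y) := by
  ext n
  rw [PowerSeries.coeff_mul, PowerSeries.coeff_mul, ← Finset.Nat.sum_antidiagonal_swap]
  refine Finset.sum_congr rfl fun p _ => ?_
  simpa using (h _ _).eq

theorem map_toRingHom_map_toRingHom {B C : Type*} [Ring B] [Algebra K B] [Ring C] [Algebra K C]
    (f : B →ₐ[K] C) (g : A →ₐ[K] B) (x : A⟦X⟧) :
    PowerSeries.map f.toRingHom (PowerSeries.map g.toRingHom x) =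
      PowerSeries.map (f.comp g).toRingHom x := by
  ext n
  simp

variable (K) in
/-- `x ↦ x ⊗ 1`. -/
def inl : A⟦X⟧ →+* (A ⊗[K] A)⟦X⟧ :=
  PowerSeries.map (Algebra.TensorProduct.includeLeft : A →ₐ[K] A ⊗[K] A).toRingHom

variable (K) in
/-- `x ↦ 1 ⊗ x`. -/
def inr : A⟦X⟧ →+* (A ⊗[K] A)⟦X⟧ :=
  PowerSeries.map (Algebra.TensorProduct.includeRight : A →ₐ[K] A ⊗[K] A).toRingHom

theorem tmul_eq (x y : A⟦X⟧) : tmul K x y = inl K x * inr K y := rfl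

theorem tmul_one (x : A⟦X⟧) : tmul K x 1 = inl K x := by rw [tmul_eq, map_one, mul_one]

theorem one_tmul (x : A⟦X⟧) : tmul K 1 x = inr K x := by rw [tmul_eq, map_one, one_mul]

theorem commute_inl_inr (x y : A⟦X⟧) : Commute (inl K x) (inr K y) :=
  commute_map _ _ (fun r s => by simp [Commute, SemiconjBy]) x y

theorem tmul_mul_tmul (x y x' y' : A⟦X⟧) :
    tmul K x y * tmul K x' y' = tmul K (x * x') (y * y') := by
  rw [tmul_eq, tmul_eq, tmul_eq, map_mul, map_mul,
    (commute_inl_inr x' y).symm.mul_mul_mul_comm]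

theorem tmul_add (x y z : A⟦X⟧) : tmul K x (y + z) = tmul K x y + tmul K x z := by
  rw [tmul_eq, map_add, mul_add]; rfl

theorem add_tmul (x y z : A⟦X⟧) : tmul K (x + y) z = tmul K x z + tmul K y z := by
  rw [tmul_eq, map_add, add_mul]; rfl

theorem tmul_neg (x y : A⟦X⟧) : tmul K x (-y) = -tmul K x y := by
  rw [tmul_eq, map_neg, mul_neg]; rfl

theorem neg_tmul (x y : A⟦X⟧) : tmul K (-x) y = -tmul K x y := by
  rw [tmul_eq, map_neg, neg_mul]; rfl

theorem constantCoeff_smul_eq_zero {x : A⟦X⟧} (c : K) (hx : PowerSeries.constantCoeff x = 0) :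
    PowerSeries.constantCoeff (c • x) = 0 := by
  rw [PowerSeries.constantCoeff_smul, hx, smul_zero]

theorem inl_smul (c : K) (x : A⟦X⟧) : inl K (c • x) = c • inl K x := by
  ext n
  simp [inl]

theorem inr_smul (c : K) (x : A⟦X⟧) : inr K (c • x) = c • inr K x := by
  ext n
  simp only [inr, PowerSeries.coeff_map, PowerSeries.coeff_smul]
  simp

theorem constantCoeff_inl {x : A⟦X⟧} (hx : PowerSeries.constantCoeff x = 0) :
    PowerSeries.constantCoeff (inl K x) = 0 := by
  rw [← PowerSeries.coeff_zero_eq_constantCoeff_apply] at hx ⊢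
  rw [inl, PowerSeries.coeff_map, hx, map_zero]

theorem constantCoeff_inr {x : A⟦X⟧} (hx : PowerSeries.constantCoeff x = 0) :
    PowerSeries.constantCoeff (inr K x) = 0 := by
  rw [← PowerSeries.coeff_zero_eq_constantCoeff_apply] at hx ⊢
  rw [inr, PowerSeries.coeff_map, hx, map_zero]

theorem constantCoeff_tmul_of_left {x : A⟦X⟧} (hx : PowerSeries.constantCoeff x = 0) (y : A⟦X⟧) :
    PowerSeries.constantCoeff (tmul K x y) = 0 := by
  rw [tmul_eq, map_mul, constantCoeff_inl hx, zero_mul]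

theorem constantCoeff_tmul_of_right (x : A⟦X⟧) {y : A⟦X⟧} (hy : PowerSeries.constantCoeff y = 0) :
    PowerSeries.constantCoeff (tmul K x y) = 0 := by
  rw [tmul_eq, map_mul, constantCoeff_inr hy, mul_zero]

variable (K) in
/-- `x ⊗ y ⊗ z`. -/
def tmul3 (x y z : A⟦X⟧) : (A ⊗[K] (A ⊗[K] A))⟦X⟧ :=
  leg12 (tmul K x y) * leg23 (inr K z)

/-- Both are `1 ⊗ x ⊗ 1`: the middle leg is reached from either side, which lets `tmul3` be split
after the first or after the second factor. -/
theorem leg23_inl (x : A⟦X⟧) : leg23 (inl K x) = leg12 (inr K x) := by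
  rw [leg23, leg12, inl, inr, map_toRingHom_map_toRingHom, map_toRingHom_map_toRingHom]
  congr 2

theorem commute_leg12 (Y : (A ⊗[K] A)⟦X⟧) (z : A⟦X⟧) :
    Commute (leg12 Y) (leg23 (inr K z)) := by
  rw [leg23, leg12, inr, map_toRingHom_map_toRingHom]
  refine commute_map _ _ (fun r s => ?_) _ _
  induction r with
  | zero => simp
  | tmul a b => simp [Commute, SemiconjBy]
  | add a b ha hb => rw [map_add]; exact ha.add_left hb

theorem commute_leg23 (Y : (A ⊗[K] A)⟦X⟧) (z : A⟦X⟧) :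
    Commute (leg23 Y) (leg12 (inl K z)) := by
  rw [leg23, leg12, inl, map_toRingHom_map_toRingHom]
  refine commute_map _ _ (fun r s => ?_) _ _
  simp [Commute, SemiconjBy]

theorem tmul3_mul_tmul3 (x y z x' y' z' : A⟦X⟧) :
    tmul3 K x y z * tmul3 K x' y' z' = tmul3 K (x * x') (y * y') (z * z') := by
  rw [tmul3, tmul3, tmul3, (commute_leg12 (tmul K x' y') z).symm.mul_mul_mul_comm,
    ← map_mul, ← map_mul, ← map_mul, tmul_mul_tmul]

theorem tmul3_sub_mid (x y y' z : A⟦X⟧) :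
    tmul3 K x (y - y') z = tmul3 K x y z - tmul3 K x y' z := by
  simp only [tmul3, tmul_eq, map_sub, map_mul, mul_sub, sub_mul]

theorem constantCoeff_map_toRingHom {B : Type*} [Ring B] [Algebra K B] (φ : A →ₐ[K] B) {x : A⟦X⟧}
    (hx : PowerSeries.constantCoeff x = 0) :
    PowerSeries.constantCoeff (PowerSeries.map φ.toRingHom x) = 0 := by
  rw [← PowerSeries.coeff_zero_eq_constantCoeff_apply] at hx ⊢
  rw [PowerSeries.coeff_map, hx, map_zero]

theorem constantCoeff_leg12 {Y : (A ⊗[K] A)⟦X⟧} (h : PowerSeries.constantCoeff Y = 0) :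
    PowerSeries.constantCoeff (leg12 Y) = 0 :=
  constantCoeff_map_toRingHom _ h

theorem constantCoeff_leg23 {Y : (A ⊗[K] A)⟦X⟧} (h : PowerSeries.constantCoeff Y = 0) :
    PowerSeries.constantCoeff (leg23 Y) = 0 :=
  constantCoeff_map_toRingHom _ h

theorem leg12_tmul (x y : A⟦X⟧) : leg12 (tmul K x y) = tmul3 K x y 1 := by
  rw [tmul3, map_one, map_one, mul_one]

theorem leg23_tmul (x y : A⟦X⟧) : leg23 (tmul K x y) = tmul3 K 1 x y := by
  rw [tmul3, one_tmul, tmul_eq, map_mul, leg23_inl]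

theorem tmul3_eq (x y z : A⟦X⟧) : tmul3 K x y z = leg12 (inl K x) * leg23 (tmul K y z) := by
  rw [tmul3, tmul_eq, tmul_eq, map_mul, map_mul, leg23_inl, mul_assoc]

variable (K) in
theorem constantCoeff_tmul3_left {x : A⟦X⟧} (hx : PowerSeries.constantCoeff x = 0) (y z : A⟦X⟧) :
    PowerSeries.constantCoeff (tmul3 K x y z) = 0 := by
  rw [tmul3, map_mul, constantCoeff_leg12 (constantCoeff_tmul_of_left hx y), zero_mul]

variable (K) in
theorem constantCoeff_tmul3_mid (x : A⟦X⟧) {y : A⟦X⟧} (hy : PowerSeries.constantCoeff y = 0)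
    (z : A⟦X⟧) : PowerSeries.constantCoeff (tmul3 K x y z) = 0 := by
  rw [tmul3, map_mul, constantCoeff_leg12 (constantCoeff_tmul_of_right x hy), zero_mul]

variable (K) in
theorem constantCoeff_tmul3_right (x y : A⟦X⟧) {z : A⟦X⟧}
    (hz : PowerSeries.constantCoeff z = 0) : PowerSeries.constantCoeff (tmul3 K x y z) = 0 := by
  rw [tmul3, map_mul, constantCoeff_leg23 (constantCoeff_inr hz), mul_zero]

variable (K) in
theorem commute_tmul3 {x y z x' y' z' : A⟦X⟧} (hx : Commute x x') (hy : Commute y y')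
    (hz : Commute z z') : Commute (tmul3 K x y z) (tmul3 K x' y' z') := by
  rw [Commute, SemiconjBy, tmul3_mul_tmul3, tmul3_mul_tmul3, hx.eq, hy.eq, hz.eq]

theorem commute_tmul {x y x' y' : A⟦X⟧} (hx : Commute x x') (hy : Commute y y') :
    Commute (tmul K x y) (tmul K x' y') := by
  rw [Commute, SemiconjBy, tmul_mul_tmul, tmul_mul_tmul, hx.eq, hy.eq]

/-- `a ⊗ b` commutes with `h ⊗ 1 + 1 ⊗ h` if `a` and `b` have opposite weights for `h`. -/
theorem commute_tmul_of_weight {a b h : A⟦X⟧} (c : K) (ha : h * a = a * h + (-c) • a)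
    (hb : h * b = b * h + c • b) : Commute (tmul K a b) (tmul K h 1 + tmul K 1 h) := by
  have h1 : tmul K (c • a) b = tmul K a (c • b) := by
    rw [tmul_eq, tmul_eq, inl_smul, inr_smul, smul_mul_assoc, mul_smul_comm]
  rw [Commute, SemiconjBy, mul_add, add_mul]
  simp only [tmul_mul_tmul, mul_one, one_mul, ha, hb, add_tmul, tmul_add, neg_smul, neg_tmul, h1]
  abel

end Legs

/-! ### Coproduct and counit on legs; composition of twists. -/

section BialgebraLegs

variable {K A : Type*} [Field K] [Ring A] [Bialgebra K A]

variable (K) in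
/-- The counit of `A⟦X⟧`. -/
def counitₕ : A⟦X⟧ →+* K⟦X⟧ :=
  PowerSeries.map (Bialgebra.counitAlgHom K A).toRingHom

theorem comulₕ_smul (c : K) (x : A⟦X⟧) : comulₕ (c • x) = c • comulₕ (K := K) x := by
  ext n
  simp [comulₕ]

theorem comulLeft_inl (x : A⟦X⟧) : comulLeft (inl K x) = leg12 (comulₕ x) := by
  rw [comulLeft, leg12, inl, comulₕ, map_toRingHom_map_toRingHom, map_toRingHom_map_toRingHom]
  congr 2
  ext a
  change (Algebra.TensorProduct.assoc K K K A A A)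
      (Algebra.TensorProduct.map (Bialgebra.comulAlgHom K A) (AlgHom.id K A) (a ⊗ₜ 1)) =
    Algebra.TensorProduct.map (AlgHom.id K A) Algebra.TensorProduct.includeLeft
      (Bialgebra.comulAlgHom K A a)
  rw [Algebra.TensorProduct.map_tmul, map_one]
  generalize (Bialgebra.comulAlgHom K A) a = t
  induction t with
  | zero => simp
  | tmul a b => simp
  | add a b ha hb => rw [TensorProduct.add_tmul, map_add, ha, hb, map_add]

theorem comulLeft_inr (x : A⟦X⟧) : comulLeft (inr K x) = leg23 (inr K x) := by
  rw [comulLeft, leg23, inr, map_toRingHom_map_toRingHom, map_toRingHom_map_toRingHom]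
  congr 2
  ext a
  simp [Algebra.TensorProduct.one_def]

theorem comulRight_inl (x : A⟦X⟧) : comulRight (inl K x) = leg12 (inl K x) := by
  rw [comulRight, leg12, inl, map_toRingHom_map_toRingHom, map_toRingHom_map_toRingHom]
  congr 2
  ext a
  simp [Algebra.TensorProduct.one_def]

theorem comulRight_inr (x : A⟦X⟧) : comulRight (inr K x) = leg23 (comulₕ x) := by
  rw [comulRight, leg23, inr, comulₕ, map_toRingHom_map_toRingHom, map_toRingHom_map_toRingHom]
  congr 2

theorem counitLeft_inl (x : A⟦X⟧) : counitLeft (inl K x) = scalar A (counitₕ K x) := by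
  rw [counitLeft, inl, counitₕ, map_toRingHom_map_toRingHom]
  ext n
  simp [scalar, Algebra.algebraMap_eq_smul_one]

theorem counitRight_inr (x : A⟦X⟧) : counitRight (inr K x) = scalar A (counitₕ K x) := by
  rw [counitRight, inr, counitₕ, map_toRingHom_map_toRingHom]
  ext n
  simp [scalar, Algebra.algebraMap_eq_smul_one]

theorem scalar_zero : scalar A (0 : K⟦X⟧) = 0 := map_zero (PowerSeries.map (algebraMap K A))

theorem constantCoeff_comulₕ {x : A⟦X⟧} (hx : PowerSeries.constantCoeff x = 0) :
    PowerSeries.constantCoeff (comulₕ (K := K) x) = 0 :=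
  constantCoeff_map_toRingHom _ hx

theorem constantCoeff_comulLeft {Y : (A ⊗[K] A)⟦X⟧} (h : PowerSeries.constantCoeff Y = 0) :
    PowerSeries.constantCoeff (comulLeft Y) = 0 :=
  constantCoeff_map_toRingHom _ h

theorem constantCoeff_comulRight {Y : (A ⊗[K] A)⟦X⟧} (h : PowerSeries.constantCoeff Y = 0) :
    PowerSeries.constantCoeff (comulRight Y) = 0 :=
  constantCoeff_map_toRingHom _ h

/-- `(Δ ⊗ id)(x ⊗ y) = Δ(x)₁₂ y₃`, and `F₁₂` commutes with the third leg, so only the twisted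
coproduct of `x` enters. -/
theorem semiconjBy_comulLeft_tmul {F Z : (A ⊗[K] A)⟦X⟧} {x : A⟦X⟧}
    (h : SemiconjBy F (comulₕ x) Z) (y : A⟦X⟧) :
    SemiconjBy (leg12 F) (comulLeft (tmul K x y)) (leg12 Z * leg23 (inr K y)) := by
  rw [tmul_eq, map_mul, comulLeft_inl, comulLeft_inr]
  exact (h.map leg12).mul_right (commute_leg12 F y)

theorem semiconjBy_comulRight_tmul {F Z : (A ⊗[K] A)⟦X⟧} {y : A⟦X⟧}
    (h : SemiconjBy F (comulₕ y) Z) (x : A⟦X⟧) :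
    SemiconjBy (leg23 F) (comulRight (tmul K x y)) (leg12 (inl K x) * leg23 Z) := by
  rw [tmul_eq, map_mul, comulRight_inl, comulRight_inr]
  exact SemiconjBy.mul_right (commute_leg23 F x) (h.map leg23)

theorem twistedComul_eq_iff {F Z : (A ⊗[K] A)⟦X⟧} (hF : IsUnit F) {x : A⟦X⟧} :
    twistedComul F x = Z ↔ SemiconjBy F (comulₕ x) Z := by
  rw [twistedComul, SemiconjBy]
  constructor
  · rintro rfl
    rw [Ring.inverse_mul_cancel_right _ _ hF]
  · intro h
    rw [h, Ring.mul_inverse_cancel_right _ _ hF]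

theorem isPrimitiveFor_iff {F : (A ⊗[K] A)⟦X⟧} (hF : IsUnit F) {x : A⟦X⟧} :
    IsPrimitiveFor F x ↔ SemiconjBy F (comulₕ x) (tmul K x 1 + tmul K 1 x) :=
  twistedComul_eq_iff hF

/-- Here `L` and `R` are explicit forms of `(Δ_F ⊗ id)(G)` and `(id ⊗ Δ_F)(G)`; the cocycle
condition becomes an identity in which `F` no longer appears. -/
theorem twisted_cocycle {F G : (A ⊗[K] A)⟦X⟧} (hF : IsUnit F)
    {L R : (A ⊗[K] (A ⊗[K] A))⟦X⟧}
    (hL : SemiconjBy (leg12 F) (comulLeft G) L) (hR : SemiconjBy (leg23 F) (comulRight G) R)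
    (h : leg12 G * L = leg23 G * R) :
    leg12 G * twistedComulLeft F G = leg23 G * twistedComulRight F G := by
  rw [twistedComulLeft, twistedComulRight, hL.eq, hR.eq,
    Ring.mul_inverse_cancel_right _ _ (hF.map leg12),
    Ring.mul_inverse_cancel_right _ _ (hF.map leg23), h]

theorem isTwist_one : IsTwist (1 : (A ⊗[K] A)⟦X⟧) where
  isUnit := isUnit_one
  constantCoeff_eq := map_one _
  cocycle := by simp only [map_one]
  counit_left := map_one _
  counit_right := map_one _

/-- Moving `F₁₂` to the right of `(Δ ⊗ id)(G)` turns that factor into `(Δ_F ⊗ id)(G)`. The two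
cocycle conditions then apply separately, and the move is undone on the other side. -/
theorem IsTwistOfTwisted.isTwist_mul {F G : (A ⊗[K] A)⟦X⟧} (hG : IsTwistOfTwisted F G)
    (hF : IsTwist F) : IsTwist (G * F) where
  isUnit := hG.isUnit.mul hF.isUnit
  constantCoeff_eq := by rw [map_mul, hG.constantCoeff_eq, hF.constantCoeff_eq, one_mul]
  cocycle := by
    have hL : twistedComulLeft F G * leg12 F = leg12 F * comulLeft G := by
      rw [twistedComulLeft, Ring.inverse_mul_cancel_right _ _ (hF.isUnit.map leg12)]
    have hR : twistedComulRight F G * leg23 F = leg23 F * comulRight G := by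
      rw [twistedComulRight, Ring.inverse_mul_cancel_right _ _ (hF.isUnit.map leg23)]
    calc leg12 (G * F) * comulLeft (G * F)
        = leg12 G * (leg12 F * comulLeft G) * comulLeft F := by
          simp only [map_mul, mul_assoc]
      _ = leg12 G * twistedComulLeft F G * (leg12 F * comulLeft F) := by
          rw [← hL]; simp only [mul_assoc]
      _ = leg23 G * (twistedComulRight F G * leg23 F) * comulRight F := by
          rw [hG.cocycle, hF.cocycle]; simp only [mul_assoc]
      _ = leg23 (G * F) * comulRight (G * F) := by
          rw [hR]; simp only [map_mul, mul_assoc]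
  counit_left := by rw [map_mul, hG.counit_left, hF.counit_left, one_mul]
  counit_right := by rw [map_mul, hG.counit_right, hF.counit_right, one_mul]

end BialgebraLegs

/-! ### Jordanian twists and their extension factors in a general bialgebra. -/

section GeneralTwists

variable {K A : Type*} [Field K] [CharZero K] [Ring A] [Bialgebra K A]

theorem counitLeft_formalExp_tmul {x : A⟦X⟧} (hx : counitₕ K x = 0) (y : A⟦X⟧) :
    counitLeft (formalExp K (tmul K x y)) = 1 := by
  rw [counitLeft, map_formalExp]
  change formalExp K (counitLeft (tmul K x y)) = 1
  rw [tmul_eq, map_mul, counitLeft_inl, hx, scalar_zero, zero_mul, formalExp_zero]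

theorem counitRight_formalExp_tmul (x : A⟦X⟧) {y : A⟦X⟧} (hy : counitₕ K y = 0) :
    counitRight (formalExp K (tmul K x y)) = 1 := by
  rw [counitRight, map_formalExp]
  change formalExp K (counitRight (tmul K x y)) = 1
  rw [tmul_eq, map_mul, counitRight_inr, hy, scalar_zero, mul_zero, formalExp_zero]

theorem leg12_formalExp_tmul (x y : A⟦X⟧) :
    leg12 (formalExp K (tmul K x y)) = formalExp K (tmul3 K x y 1) := by
  rw [← leg12_tmul]
  exact map_formalExp _ _

theorem leg23_formalExp_tmul (x y : A⟦X⟧) :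
    leg23 (formalExp K (tmul K x y)) = formalExp K (tmul3 K 1 x y) := by
  rw [← leg23_tmul]
  exact map_formalExp _ _

theorem comulLeft_formalExp (Y : (A ⊗[K] A)⟦X⟧) :
    comulLeft (formalExp K Y) = formalExp K (comulLeft Y) := map_formalExp _ Y

theorem comulRight_formalExp (Y : (A ⊗[K] A)⟦X⟧) :
    comulRight (formalExp K Y) = formalExp K (comulRight Y) := map_formalExp _ Y

theorem counitₕ_formalLogOneAdd {x : A⟦X⟧} (hx : counitₕ K x = 0) :
    counitₕ K (formalLogOneAdd K x) = 0 := by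
  rw [counitₕ, map_formalLogOneAdd]
  change formalLogOneAdd K (counitₕ K x) = 0
  rw [hx, formalLogOneAdd_zero]

theorem inl_formalExp (x : A⟦X⟧) : inl K (formalExp K x) = formalExp K (inl K x) :=
  map_formalExp _ x

theorem inr_formalExp (x : A⟦X⟧) : inr K (formalExp K x) = formalExp K (inr K x) :=
  map_formalExp _ x

theorem inl_formalLogOneAdd (x : A⟦X⟧) :
    inl K (formalLogOneAdd K x) = formalLogOneAdd K (inl K x) :=
  map_formalLogOneAdd _ x

theorem inr_formalLogOneAdd (x : A⟦X⟧) :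
    inr K (formalLogOneAdd K x) = formalLogOneAdd K (inr K x) :=
  map_formalLogOneAdd _ x

/-- `exp(x ⊗ σ) (y ⊗ 1) = (y ⊗ e^{cσ}) exp(x ⊗ σ)` if `[x, y] = c y`. -/
theorem formalExp_tmul_semiconjBy_left {x y s : A⟦X⟧} (c : K)
    (hs : PowerSeries.constantCoeff s = 0) (h : x * y = y * x + c • y) :
    SemiconjBy (formalExp K (tmul K x s)) (tmul K y 1) (tmul K y (formalExp K (c • s))) := by
  have hcs : PowerSeries.constantCoeff (c • s) = 0 := by
    rw [PowerSeries.constantCoeff_smul, hs, smul_zero]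
  have h1 : tmul K (c • y) s = tmul K y (c • s) := by
    ext n
    simp only [tmul, PowerSeries.coeff_mul, PowerSeries.coeff_map, PowerSeries.coeff_smul]
    simp
  have := formalExp_mul_of_semiconjBy (K := K) (x := tmul K x s) (y := tmul K y 1)
    (z := tmul K 1 (c • s)) (constantCoeff_tmul_of_right x hs)
    (constantCoeff_tmul_of_right 1 hcs)
    (by rw [mul_add, tmul_mul_tmul, tmul_mul_tmul, tmul_mul_tmul, h, add_tmul]
        simp only [mul_one, one_mul]
        rw [h1, add_comm])
    (commute_tmul (Commute.one_left x) ((Commute.refl s).smul_left c))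
  rw [SemiconjBy, this, one_tmul, ← inr_formalExp, tmul_one, ← tmul_eq]

/-- Conjugation by `Φ` fixes `1 ⊗ e` and sends `e ⊗ 1` to `e ⊗ (1 + e)`, so `1 + e ⊗ 1 + 1 ⊗ e`
becomes `(1 + e) ⊗ (1 + e)`. Its logarithm is a sum: `ln(1 + e)` is primitive for the Jordanian
coproduct. -/
theorem jordanian_semiconjBy_log {h e : A⟦X⟧} (he : PowerSeries.constantCoeff e = 0)
    (hhe : h * e = e * h + e) :
    SemiconjBy (formalExp K (tmul K h (formalLogOneAdd K e)))
      (formalLogOneAdd K (tmul K e 1 + tmul K 1 e))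
      (tmul K 1 (formalLogOneAdd K e) + tmul K (formalLogOneAdd K e) 1) := by
  set s := formalLogOneAdd K e with hs
  have hs0 : PowerSeries.constantCoeff s = 0 := constantCoeff_formalLogOneAdd e
  have hx0 : PowerSeries.constantCoeff (tmul K h s) = 0 := constantCoeff_tmul_of_right h hs0
  set Φ := formalExp K (tmul K h s) with hΦ
  have hcomm : Commute s e := (formalEval_commute _ he (Commute.refl e)).symm
  have c1 : SemiconjBy Φ (tmul K e 1) (tmul K e 1 + tmul K e e) := by
    have := formalExp_tmul_semiconjBy_left (K := K) (1 : K) hs0 (y := e) (x := h)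
      (by rw [one_smul, hhe])
    rwa [one_smul, hs, formalExp_formalLogOneAdd he, tmul_add, ← hs] at this
  have c2 : SemiconjBy Φ (tmul K 1 e) (tmul K 1 e) :=
    (formalEval_commute _ hx0 (commute_tmul (Commute.one_left h) hcomm.symm)).symm
  have e1 : PowerSeries.constantCoeff (tmul K e 1) = 0 := constantCoeff_tmul_of_left he 1
  have e2 : PowerSeries.constantCoeff (tmul K 1 e) = 0 := constantCoeff_tmul_of_right 1 he
  have e3 : PowerSeries.constantCoeff (tmul K e e) = 0 := constantCoeff_tmul_of_left he e
  have : tmul K 1 s + tmul K s 1 = formalLogOneAdd K (tmul K e 1 + tmul K e e + tmul K 1 e) := by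
    rw [add_comm, tmul_one, one_tmul, hs, inl_formalLogOneAdd, inr_formalLogOneAdd,
      ← formalLogOneAdd_add_formalLogOneAdd (constantCoeff_inl he) (constantCoeff_inr he)
        (commute_inl_inr e e), tmul_one, one_tmul, ← tmul_eq]
    congr 1
    abel
  rw [this]
  exact formalEval_semiconjBy _ (by simp [e1, e2]) (by simp [e1, e2, e3]) (c1.add_right c2)

/-- The Jordanian twist `exp(H ⊗ ln(1 + E))` for primitive `H`, `E` with `[H, E] = E`. -/
theorem isTwistOfTwisted_jordanian {F : (A ⊗[K] A)⟦X⟧} (hF : IsUnit F) {h e : A⟦X⟧}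
    (he : PowerSeries.constantCoeff e = 0)
    (hPh : SemiconjBy F (comulₕ h) (tmul K h 1 + tmul K 1 h))
    (hPe : SemiconjBy F (comulₕ e) (tmul K e 1 + tmul K 1 e))
    (hhe : h * e = e * h + e) (hεh : counitₕ K h = 0) (hεe : counitₕ K e = 0) :
    IsTwistOfTwisted F (formalExp K (tmul K h (formalLogOneAdd K e))) := by
  set s := formalLogOneAdd K e with hs
  have hs0 : PowerSeries.constantCoeff s = 0 := constantCoeff_formalLogOneAdd e
  have hx0 : PowerSeries.constantCoeff (tmul K h s) = 0 := constantCoeff_tmul_of_right h hs0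
  set Φ := formalExp K (tmul K h s) with hΦ
  have e1 : PowerSeries.constantCoeff (tmul K e 1) = 0 := constantCoeff_tmul_of_left he 1
  have e2 : PowerSeries.constantCoeff (tmul K 1 e) = 0 := constantCoeff_tmul_of_right 1 he
  have c3 := jordanian_semiconjBy_log (K := K) he hhe
  rw [← hs, ← hΦ] at c3
  have hPs : SemiconjBy F (comulₕ s) (formalLogOneAdd K (tmul K e 1 + tmul K 1 e)) := by
    rw [comulₕ, hs, map_formalLogOneAdd]
    exact formalEval_semiconjBy _ (constantCoeff_comulₕ he) (by simp [e1, e2]) hPe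
  have hlog0 := constantCoeff_formalLogOneAdd (K := K) (tmul K e 1 + tmul K 1 e)
  refine ⟨isUnit_formalExp hx0, constantCoeff_formalExp _,
    twisted_cocycle hF (L := formalExp K (tmul3 K h 1 s + tmul3 K 1 h s))
      (R := formalExp K (leg12 (inl K h) * leg23 (formalLogOneAdd K (tmul K e 1 + tmul K 1 e))))
      ?_ ?_ ?_, counitLeft_formalExp_tmul hεh s,
    counitRight_formalExp_tmul h (counitₕ_formalLogOneAdd hεe)⟩
  · rw [hΦ, comulLeft_formalExp]
    refine formalEval_semiconjBy _ (constantCoeff_comulLeft hx0) ?_ ?_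
    · rw [map_add, constantCoeff_tmul3_right K _ _ hs0,
        constantCoeff_tmul3_right K _ _ hs0, add_zero]
    · have := semiconjBy_comulLeft_tmul hPh s
      rwa [map_add, add_mul] at this
  · rw [hΦ, comulRight_formalExp]
    refine formalEval_semiconjBy _ (constantCoeff_comulRight hx0) ?_ ?_
    · rw [map_mul, constantCoeff_leg23 hlog0, mul_zero]
    · exact semiconjBy_comulRight_tmul hPs h
  -- Carrying `Φ₂₃` across makes the second-leg logarithm additive. Both sides then equal `exp(h ⊗ s
  -- ⊗ 1) exp(h ⊗ 1 ⊗ s) exp(1 ⊗ h ⊗ s)`.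
  · have hR : SemiconjBy (leg23 Φ)
        (formalExp K (leg12 (inl K h) * leg23 (formalLogOneAdd K (tmul K e 1 + tmul K 1 e))))
        (formalExp K (tmul3 K h 1 s + tmul3 K h s 1)) := by
      refine formalEval_semiconjBy _ ?_ ?_ ?_
      · rw [map_mul, constantCoeff_leg23 hlog0, mul_zero]
      · rw [map_add, constantCoeff_tmul3_right K _ _ hs0, constantCoeff_tmul3_mid K _ hs0, add_zero]
      · rw [tmul3_eq, tmul3_eq, ← mul_add, ← map_add]
        exact SemiconjBy.mul_right (commute_leg23 Φ h) (c3.map leg23)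
    have e12 := leg12_formalExp_tmul (K := K) h s
    have e23 := leg23_formalExp_tmul (K := K) h s
    rw [← hΦ] at e12 e23
    rw [hR.eq, e12, e23,
      formalExp_add (constantCoeff_tmul3_right K _ _ hs0) (constantCoeff_tmul3_right K _ _ hs0)
        (commute_tmul3 K (Commute.one_right _) (Commute.one_left _) (Commute.refl _)),
      ← mul_assoc, ← formalExp_add (constantCoeff_tmul3_mid K _ hs0 _)
        (constantCoeff_tmul3_right K _ _ hs0)
        (commute_tmul3 K (Commute.refl _) (Commute.one_right _) (Commute.one_left _)), add_comm]

/-- The extension factor `exp(a ⊗ b)` for `Δ(a) = a ⊗ k + 1 ⊗ a`, `Δ(b) = b ⊗ 1 + k' ⊗ b` and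
`[a, b] = k - k'`, where `k` and `k'` commute with `a` and `b`. -/
theorem isTwistOfTwisted_extension {F : (A ⊗[K] A)⟦X⟧} (hF : IsUnit F) {a b k k' : A⟦X⟧}
    (ha : PowerSeries.constantCoeff a = 0)
    (hPa : SemiconjBy F (comulₕ a) (tmul K a k + tmul K 1 a))
    (hPb : SemiconjBy F (comulₕ b) (tmul K b 1 + tmul K k' b))
    (hab : a * b = b * a + (k - k')) (hka : Commute k a) (hkb : Commute k b)
    (hka' : Commute k' a) (hkb' : Commute k' b)
    (hεa : counitₕ K a = 0) (hεb : counitₕ K b = 0) :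
    IsTwistOfTwisted F (formalExp K (tmul K a b)) := by
  have hx0 : PowerSeries.constantCoeff (tmul K a b) = 0 := constantCoeff_tmul_of_left ha b
  refine ⟨isUnit_formalExp hx0, constantCoeff_formalExp _,
    twisted_cocycle hF (L := formalExp K (tmul3 K a k b + tmul3 K 1 a b))
      (R := formalExp K (tmul3 K a b 1 + tmul3 K a k' b))
      ?_ ?_ ?_, counitLeft_formalExp_tmul hεa b, counitRight_formalExp_tmul a hεb⟩
  · rw [comulLeft_formalExp]
    refine formalEval_semiconjBy _ (constantCoeff_comulLeft hx0) ?_ ?_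
    · rw [map_add, constantCoeff_tmul3_left K ha, constantCoeff_tmul3_mid K _ ha, add_zero]
    · have := semiconjBy_comulLeft_tmul hPa b
      rwa [map_add, add_mul] at this
  · rw [comulRight_formalExp]
    refine formalEval_semiconjBy _ (constantCoeff_comulRight hx0) ?_ ?_
    · rw [map_add, constantCoeff_tmul3_left K ha, constantCoeff_tmul3_left K ha, add_zero]
    · have := semiconjBy_comulRight_tmul hPb a
      rwa [map_add, mul_add, ← tmul3_eq, ← tmul3_eq] at this
  · have hkk : Commute (k - k') a := hka.sub_left hka'
    have hkk' : Commute (k - k') b := hkb.sub_left hkb'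
    -- That `k` and `k'` commute is not assumed: `k - k' = [a, b]`, and `k'` commutes with `a` and
    -- `b`.
    have hkc : Commute k' (k - k') := by
      have h1 : k - k' = a * b - b * a := by rw [hab]; abel
      rw [h1]
      exact (hka'.mul_right hkb').sub_right (hkb'.mul_right hka')
    -- Exchanging `exp(1 ⊗ a ⊗ b)` with `exp(a ⊗ b ⊗ 1)` costs `exp(a ⊗ (k - k') ⊗ b)`, exactly what
    -- converts `exp(a ⊗ k' ⊗ b)` into `exp(a ⊗ k ⊗ b)`.
    have key := formalExp_mul_formalExp_of_central (K := K) (x := tmul3 K 1 a b)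
      (y := tmul3 K a b 1) (c := tmul3 K a (k - k') b) (constantCoeff_tmul3_mid K _ ha _)
      (constantCoeff_tmul3_left K ha _ _) (constantCoeff_tmul3_left K ha _ _)
      (by rw [tmul3_mul_tmul3, tmul3_mul_tmul3, hab]
          simp only [mul_one, one_mul, tmul3, tmul_add, map_add, add_mul])
      (commute_tmul3 K (Commute.one_left _) hkk.symm (Commute.refl _))
      (commute_tmul3 K (Commute.refl _) hkk'.symm (Commute.one_left _))
    have hc0 : Commute (tmul3 K a k' b) (tmul3 K 1 a b) :=
      commute_tmul3 K (Commute.one_right _) hka' (Commute.refl _)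
    have hc1 : Commute (formalExp K (tmul3 K 1 a b)) (formalExp K (tmul3 K a k' b)) :=
      formalEval_commute _ (constantCoeff_tmul3_left K ha _ _)
        (formalEval_commute _ (constantCoeff_tmul3_mid K 1 ha b) hc0).symm
    rw [leg12_formalExp_tmul a b, leg23_formalExp_tmul a b,
      formalExp_add (constantCoeff_tmul3_left K ha _ _) (constantCoeff_tmul3_mid K _ ha _)
        (commute_tmul3 K (Commute.one_right _) hka (Commute.refl _)),
      formalExp_add (constantCoeff_tmul3_left K ha _ _) (constantCoeff_tmul3_left K ha _ _)
        (commute_tmul3 K (Commute.refl _) hkb'.symm (Commute.one_left _)),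
      ← mul_assoc (formalExp K (tmul3 K 1 a b)), key, mul_assoc _ (formalExp K (tmul3 K 1 a b)),
      hc1.eq, ← mul_assoc, ← mul_assoc, mul_assoc (formalExp K (tmul3 K a b 1)) (formalExp K _)
        (formalExp K (tmul3 K a k' b)),
      ← formalExp_add (constantCoeff_tmul3_left K ha _ _) (constantCoeff_tmul3_left K ha _ _)
        (commute_tmul3 K (Commute.refl _) hkc.symm (Commute.refl _)), tmul3_sub_mid, sub_add_cancel]

theorem formalExp_tmul_semiconjBy_of_commute {a b : A⟦X⟧} {Z : (A ⊗[K] A)⟦X⟧}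
    (hab : PowerSeries.constantCoeff (tmul K a b) = 0) (h : Commute (tmul K a b) Z) :
    SemiconjBy (formalExp K (tmul K a b)) Z Z :=
  (formalEval_commute _ hab h.symm).symm

/-- The Jordanian coproduct of an element of weight `c` that commutes with `e`. -/
theorem jordanian_semiconjBy_comulₕ {h e x : A⟦X⟧} (c : K)
    (he : PowerSeries.constantCoeff e = 0) (hx : h * x = x * h + c • x) (hxe : Commute x e)
    (hΔ : comulₕ x = tmul K x 1 + tmul K 1 x) :
    SemiconjBy (formalExp K (tmul K h (formalLogOneAdd K e))) (comulₕ x)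
      (tmul K x (formalExp K (c • formalLogOneAdd K e)) + tmul K 1 x) := by
  have hs0 := constantCoeff_formalLogOneAdd (K := K) e
  rw [hΔ]
  exact (formalExp_tmul_semiconjBy_left c hs0 hx).add_right
    (formalExp_tmul_semiconjBy_of_commute (constantCoeff_tmul_of_right h hs0)
      (commute_tmul (Commute.one_right h) (formalEval_commute _ he hxe).symm))

/-- Powers `e^{cσ}` are group-like for the Jordanian coproduct. -/
theorem jordanian_semiconjBy_comulₕ_exp {h e : A⟦X⟧} (c : K)
    (he : PowerSeries.constantCoeff e = 0) (hhe : h * e = e * h + e)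
    (hΔ : comulₕ e = tmul K e 1 + tmul K 1 e) :
    SemiconjBy (formalExp K (tmul K h (formalLogOneAdd K e)))
      (comulₕ (formalExp K (c • formalLogOneAdd K e)))
      (tmul K (formalExp K (c • formalLogOneAdd K e))
        (formalExp K (c • formalLogOneAdd K e))) := by
  have hlog := jordanian_semiconjBy_log (K := K) he hhe
  have hs0 := constantCoeff_smul_eq_zero c (constantCoeff_formalLogOneAdd (K := K) e)
  have h1 : comulₕ (formalExp K (c • formalLogOneAdd K e)) =
      formalExp K (c • formalLogOneAdd K (tmul K e 1 + tmul K 1 e)) := by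
    rw [← hΔ]
    refine (map_formalExp _ _).trans ?_
    congr 1
    exact (comulₕ_smul c _).trans (congrArg (c • ·) (map_formalLogOneAdd _ _))
  have h2 : tmul K (formalExp K (c • formalLogOneAdd K e))
      (formalExp K (c • formalLogOneAdd K e)) =
      formalExp K (c • (tmul K 1 (formalLogOneAdd K e) + tmul K (formalLogOneAdd K e) 1)) := by
    rw [tmul_eq, inl_formalExp, inr_formalExp, ← formalExp_add (constantCoeff_inl hs0)
      (constantCoeff_inr hs0) (commute_inl_inr _ _), inl_smul, inr_smul, ← smul_add, tmul_one,
      one_tmul, add_comm]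
  rw [h1, h2]
  refine formalEval_semiconjBy _
    (constantCoeff_smul_eq_zero c (constantCoeff_formalLogOneAdd _))
    (constantCoeff_smul_eq_zero c ?_) ?_
  · rw [map_add, constantCoeff_tmul_of_right _ (constantCoeff_formalLogOneAdd e),
      constantCoeff_tmul_of_left (constantCoeff_formalLogOneAdd e), add_zero]
  · rw [SemiconjBy, mul_smul_comm, smul_mul_assoc, hlog.eq]

/-- Conjugation of `b ⊗ 1 + k' ⊗ b` by the extension factor `exp(a ⊗ b)`. -/
theorem extension_semiconjBy {a b k k' : A⟦X⟧} (ha : PowerSeries.constantCoeff a = 0)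
    (hab : a * b = b * a + (k - k')) (hka : Commute k a) (hka' : Commute k' a) :
    SemiconjBy (formalExp K (tmul K a b)) (tmul K b 1 + tmul K k' b)
      (tmul K b 1 + tmul K k b) := by
  -- The commutator with `b ⊗ 1` is `(k - k') ⊗ b`, which commutes with `a ⊗ b`; the term `k' ⊗ b`
  -- does not contribute.
  have h := formalExp_semiconjBy_add (K := K) (x := tmul K a b) (y := tmul K b 1 + tmul K k' b)
    (c := tmul K (k - k') b) (constantCoeff_tmul_of_left ha b)
    (by rw [mul_add, add_mul, tmul_mul_tmul, tmul_mul_tmul, tmul_mul_tmul, tmul_mul_tmul, hab,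
          hka'.eq, add_tmul, mul_one, one_mul]
        abel)
    (commute_tmul (hka.sub_left hka').symm (Commute.refl b))
  have h2 : tmul K b 1 + tmul K k b = tmul K b 1 + tmul K k' b + tmul K (k - k') b := by
    rw [add_assoc, ← add_tmul, add_sub_cancel]
  rwa [h2]

end GeneralTwists

/-! ### Central scalar series. -/

section Scalars

variable {K A : Type*} [Field K] [Ring A] [Algebra K A]

theorem commute_scalar (c : K⟦X⟧) (x : A⟦X⟧) : Commute (scalar A c) x := by
  have := commute_map (algebraMap K A) (RingHom.id A) (fun r s => Algebra.commutes r s) c x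
  simpa [scalar, PowerSeries.map_id] using this

theorem map_scalar {B : Type*} [Ring B] [Algebra K B] (φ : A →ₐ[K] B) (c : K⟦X⟧) :
    PowerSeries.map φ.toRingHom (scalar A c) = scalar B c := by
  ext n
  simp [scalar]

theorem inl_scalar (c : K⟦X⟧) : inl K (scalar A c) = scalar (A ⊗[K] A) c := map_scalar _ c

theorem inr_scalar (c : K⟦X⟧) : inr K (scalar A c) = scalar (A ⊗[K] A) c := map_scalar _ c

theorem scalar_mul_tmul (c : K⟦X⟧) (x y : A⟦X⟧) :
    scalar (A ⊗[K] A) c * tmul K x y = tmul K (scalar A c * x) y := by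
  rw [tmul_eq, tmul_eq, map_mul, inl_scalar, mul_assoc]

theorem tmul_scalar_mul (c : K⟦X⟧) (x y : A⟦X⟧) :
    tmul K x (scalar A c * y) = scalar (A ⊗[K] A) c * tmul K x y := by
  rw [tmul_eq, tmul_eq, map_mul, inr_scalar, ← mul_assoc, ← mul_assoc,
    (commute_scalar c (inl K x)).eq]

theorem constantCoeff_scalar_mul {c : K⟦X⟧} (hc : PowerSeries.constantCoeff c = 0) (x : A⟦X⟧) :
    PowerSeries.constantCoeff (scalar A c * x) = 0 := by
  rw [map_mul, ← PowerSeries.coeff_zero_eq_constantCoeff_apply (scalar A c), scalar,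
    PowerSeries.coeff_map, PowerSeries.coeff_zero_eq_constantCoeff_apply, hc, map_zero, zero_mul]

end Scalars

section ScalarsBialgebra

variable {K A : Type*} [Field K] [Ring A] [Bialgebra K A]

theorem comulₕ_scalar (c : K⟦X⟧) : comulₕ (scalar A c) = scalar (A ⊗[K] A) c := map_scalar _ c

/-- Scalar multiples of primitive elements are primitive. -/
theorem semiconjBy_comulₕ_scalar_mul {F : (A ⊗[K] A)⟦X⟧} {x : A⟦X⟧} (c : K⟦X⟧)
    (h : SemiconjBy F (comulₕ x) (tmul K x 1 + tmul K 1 x)) :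
    SemiconjBy F (comulₕ (scalar A c * x))
      (tmul K (scalar A c * x) 1 + tmul K 1 (scalar A c * x)) := by
  rw [map_mul, comulₕ_scalar, tmul_scalar_mul, ← scalar_mul_tmul, ← mul_add]
  exact SemiconjBy.mul_right (commute_scalar c F).symm h

end ScalarsBialgebra

/-! ### Commutation relations of `sl(4)` inside its enveloping algebra. -/

section SL4

attribute [local instance 100] LieRing.ofAssociativeRing

open LieAlgebra.SpecialLinear

variable {K : Type*} [Field K]

variable (K) in
/-- An element of `sl(4)`, as a constant series in `U(sl(4))⟦X⟧`. -/
def genSL4 (x : sl (Fin 4) K) : (USL4 K)⟦X⟧ :=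
  PowerSeries.C (UniversalEnvelopingAlgebra.ι K x)

theorem genSL4_mul (x y : sl (Fin 4) K) :
    genSL4 K x * genSL4 K y = genSL4 K y * genSL4 K x + genSL4 K ⁅x, y⁆ := by
  rw [genSL4, genSL4, genSL4, LieHom.map_lie, LieRing.of_associative_ring_bracket, map_sub,
    map_mul, map_mul, add_sub_cancel]

theorem genSL4_smul (c : K) (x : sl (Fin 4) K) : genSL4 K (c • x) = c • genSL4 K x := by
  ext n
  simp only [genSL4, map_smul, PowerSeries.coeff_smul, PowerSeries.coeff_C]
  split_ifs <;> simp

theorem genSL4_zero : genSL4 K 0 = 0 := by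
  rw [genSL4, map_zero, map_zero]

theorem comulₕ_genSL4 (x : sl (Fin 4) K) :
    comulₕ (genSL4 K x) = tmul K (genSL4 K x) 1 + tmul K 1 (genSL4 K x) := by
  rw [tmul_one, one_tmul, genSL4, comulₕ, inl, inr, PowerSeries.map_C, PowerSeries.map_C,
    PowerSeries.map_C, ← map_add]
  congr 1
  exact UniversalEnvelopingAlgebra.comulHom_ι K _ x

theorem counitₕ_genSL4 (x : sl (Fin 4) K) : counitₕ K (genSL4 K x) = 0 := by
  rw [genSL4, counitₕ, PowerSeries.map_C]
  exact (congrArg _ (UniversalEnvelopingAlgebra.counitHom_ι K _ x)).trans (map_zero _)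

theorem E_eq (i j : Fin 4) (h : i ≠ j) : E K i j h = genSL4 K (single i j h 1) := rfl

theorem H_eq (i j : Fin 4) : H K i j = genSL4 K (singleSubSingle i j (1 / 2)) := rfl

theorem E_commute {i j k l : Fin 4} (hij : i ≠ j) (hkl : k ≠ l) (hjk : j ≠ k) (hil : l ≠ i) :
    Commute (E K i j hij) (E K k l hkl) := by
  rw [Commute, SemiconjBy, E_eq, E_eq, genSL4_mul]
  have : ⁅single i j hij (1 : K), single k l hkl (1 : K)⁆ = 0 := by
    apply Subtype.ext
    rw [sl_bracket, val_single, val_single,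
      Matrix.single_mul_single_of_ne _ _ _ _ hjk, Matrix.single_mul_single_of_ne _ _ _ _ hil]
    simp
  rw [this, genSL4_zero, add_zero]

theorem E_mul_E {i j l : Fin 4} (hij : i ≠ j) (hjl : j ≠ l) (hil : i ≠ l) :
    E K i j hij * E K j l hjl = E K j l hjl * E K i j hij + E K i l hil := by
  rw [E_eq, E_eq, E_eq, genSL4_mul]
  congr 2
  apply Subtype.ext
  rw [sl_bracket, val_single, val_single,
    val_single, Matrix.single_mul_single_same, Matrix.single_mul_single_of_ne _ _ _ _ hil.symm]
  simp

theorem H_mul_E (i j k l : Fin 4) (h : k ≠ l) :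
    H K i j * E K k l h = E K k l h * H K i j +
      ((((if i = k then 1 else 0) - (if i = l then 1 else 0) - (if j = k then 1 else 0) +
        (if j = l then 1 else 0) : K)) / 2) • E K k l h := by
  rw [E_eq, H_eq, genSL4_mul, ← genSL4_smul]
  congr 2
  apply Subtype.ext
  have hl : ∀ a, Matrix.single a a (1 / 2 : K) * Matrix.single k l 1 =
      (if a = k then (1 / 2 : K) else 0) • Matrix.single k l 1 := by
    intro a
    split_ifs with ha
    · subst ha
      rw [Matrix.single_mul_single_same, Matrix.smul_single, smul_eq_mul]
    · rw [Matrix.single_mul_single_of_ne _ _ _ _ ha, zero_smul]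
  have hr : ∀ a, Matrix.single k l (1 : K) * Matrix.single a a (1 / 2) =
      (if a = l then (1 / 2 : K) else 0) • Matrix.single k l 1 := by
    intro a
    split_ifs with ha
    · subst ha
      rw [Matrix.single_mul_single_same, Matrix.smul_single, smul_eq_mul, mul_comm]
    · rw [Matrix.single_mul_single_of_ne _ _ _ _ (Ne.symm ha), zero_smul]
  rw [sl_bracket, val_single, val_singleSubSingle, sub_mul, mul_sub, hl, hl, hr, hr]
  change _ = _ • Matrix.single k l (1 : K)
  rw [← sub_smul, ← sub_smul, ← sub_smul]
  congr 1
  split_ifs <;> ring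

theorem H_commute (i j k l : Fin 4) : Commute (H K i j) (H K k l) := by
  rw [Commute, SemiconjBy, H_eq, H_eq, genSL4_mul]
  have : ⁅singleSubSingle i j (1 / 2 : K), singleSubSingle k l (1 / 2 : K)⁆ = 0 := by
    apply Subtype.ext
    rw [sl_bracket, val_singleSubSingle,
      val_singleSubSingle]
    have hd : ∀ a : Fin 4, Matrix.single a a (1 / 2 : K) = Matrix.diagonal (Pi.single a (1 / 2)) :=
      fun a => (Matrix.diagonal_single a _).symm
    simp only [hd, Matrix.diagonal_sub, Matrix.diagonal_mul_diagonal]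
    refine (congrArg Matrix.diagonal (funext fun a => ?_)).trans Matrix.diagonal_zero
    ring
  rw [this, genSL4_zero, add_zero]

end SL4

/-! ### The extended twist of `U(sl(4))` and the primitivity of `H₂₃`. -/

section SL4Twists

variable {K : Type*} [Field K]

theorem comulₕ_E (i j : Fin 4) (h : i ≠ j) :
    comulₕ (E K i j h) = tmul K (E K i j h) 1 + tmul K 1 (E K i j h) := comulₕ_genSL4 _

theorem comulₕ_H (i j : Fin 4) :
    comulₕ (H K i j) = tmul K (H K i j) 1 + tmul K 1 (H K i j) := comulₕ_genSL4 _

theorem counitₕ_E (i j : Fin 4) (h : i ≠ j) : counitₕ K (E K i j h) = 0 := counitₕ_genSL4 _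

theorem counitₕ_H (i j : Fin 4) : counitₕ K (H K i j) = 0 := counitₕ_genSL4 _

theorem comulₕ_scalar_mul_E (ξ : K⟦X⟧) (i j : Fin 4) (h : i ≠ j) :
    comulₕ (scalar _ ξ * E K i j h) =
      tmul K (scalar _ ξ * E K i j h) 1 + tmul K 1 (scalar _ ξ * E K i j h) := by
  rw [map_mul, comulₕ_scalar, comulₕ_E, tmul_scalar_mul, ← scalar_mul_tmul, mul_add]

theorem counitₕ_scalar_mul (ξ : K⟦X⟧) {x : (USL4 K)⟦X⟧} (hx : counitₕ K x = 0) :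
    counitₕ K (scalar _ ξ * x) = 0 := by
  rw [map_mul, hx, mul_zero]

theorem E_commute_E14 {i j : Fin 4} (h : i ≠ j) (hj : j ≠ 0) (hi : i ≠ 3) :
    Commute (E K i j h) (E K 0 3) :=
  E_commute h _ hj hi.symm

theorem E12_mul_E24 : E K 0 1 * E K 1 3 = E K 1 3 * E K 0 1 + E K 0 3 := E_mul_E _ _ _

/-- The sign in `ΦE'` is there so that `(-E₃₄, E₁₃)` satisfies the same relation as `(E₁₂, E₂₄)`,
and one lemma treats both factors. -/
theorem neg_E34_mul_E13 : -E K 2 3 * E K 0 2 = E K 0 2 * -E K 2 3 + E K 0 3 := by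
  have h : E K 0 2 * E K 2 3 = E K 2 3 * E K 0 2 + E K 0 3 := E_mul_E _ _ _
  rw [neg_mul, mul_neg, h]
  abel

theorem commute_scalar_mul {A : Type*} [Ring A] [Algebra K A] {x y : A⟦X⟧} (c d : K⟦X⟧)
    (h : Commute x y) : Commute (scalar A c * x) (scalar A d * y) :=
  Commute.mul_left (commute_scalar c _) ((commute_scalar d x).symm.mul_right h)

theorem scalar_mul_commute {A : Type*} [Ring A] [Algebra K A] {x y : A⟦X⟧} (c : K⟦X⟧)
    (h : Commute x y) : Commute (scalar A c * x) y :=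
  Commute.mul_left (commute_scalar c _) h

theorem weight_scalar_mul {ξ : K⟦X⟧} {h x : (USL4 K)⟦X⟧} {c : K}
    (hx : h * x = x * h + c • x) :
    h * (scalar _ ξ * x) = scalar _ ξ * x * h + c • (scalar _ ξ * x) := by
  rw [← mul_assoc, ← (commute_scalar ξ h).eq, mul_assoc, hx, mul_add, mul_assoc, mul_smul_comm]

variable [CharZero K] {ξ : K⟦X⟧}

theorem H_mul_E_of_weight (c : K) {i j k l : Fin 4} (h : k ≠ l)
    (hc : ((if i = k then 1 else 0) - (if i = l then 1 else 0) - (if j = k then 1 else 0) +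
      (if j = l then 1 else 0) : K) = 2 * c) :
    H K i j * E K k l h = E K k l h * H K i j + c • E K k l h := by
  rw [H_mul_E, hc, mul_div_cancel_left₀ c two_ne_zero]

/-- `e^{c σ₁₄}`. -/
def expσ (c : K) (ξ : K⟦X⟧) : (USL4 K)⟦X⟧ := formalExp K (c • σ₁₄ ξ)

theorem constantCoeff_σ₁₄ (ξ : K⟦X⟧) : PowerSeries.constantCoeff (σ₁₄ ξ) = 0 :=
  constantCoeff_formalLogOneAdd _

theorem expσ_mul_expσ (c d : K) : expσ c ξ * expσ d ξ = expσ (c + d) ξ := by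
  rw [expσ, expσ, expσ, add_smul, formalExp_add
    (constantCoeff_smul_eq_zero c (constantCoeff_σ₁₄ ξ))
    (constantCoeff_smul_eq_zero d (constantCoeff_σ₁₄ ξ))
    (((Commute.refl (σ₁₄ ξ)).smul_left c).smul_right d)]

theorem expσ_zero : expσ (0 : K) ξ = 1 := by rw [expσ, zero_smul, formalExp_zero]

theorem expσ_one (hξ : PowerSeries.constantCoeff ξ = 0) :
    expσ (1 : K) ξ = 1 + scalar _ ξ * E K 0 3 := by
  rw [expσ, one_smul, σ₁₄, formalExp_formalLogOneAdd (constantCoeff_scalar_mul hξ _)]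

theorem expσ_neg_one : expσ (-1 : K) ξ = formalExp K (-σ₁₄ ξ) := by
  rw [expσ, neg_smul, one_smul]

theorem commute_expσ (hξ : PowerSeries.constantCoeff ξ = 0) {x : (USL4 K)⟦X⟧}
    (h : Commute x (E K 0 3)) (c : K) : Commute x (expσ c ξ) := by
  refine formalEval_commute _ (constantCoeff_smul_eq_zero c (constantCoeff_σ₁₄ ξ)) ?_
  refine Commute.smul_right (formalEval_commute _ (constantCoeff_scalar_mul hξ _) ?_) c
  exact (commute_scalar ξ x).symm.mul_right h

theorem expσ_half_mul_neg_half : expσ (1 / 2 : K) ξ * expσ (-1 / 2) ξ = 1 := by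
  rw [expσ_mul_expσ, ← expσ_zero (K := K) (ξ := ξ)]
  congr 1
  ring

theorem expσ_neg_half_mul_half : expσ (-1 / 2 : K) ξ * expσ (1 / 2) ξ = 1 := by
  rw [expσ_mul_expσ, ← expσ_zero (K := K) (ξ := ξ)]
  congr 1
  ring

theorem expσ_half_mul_half (hξ : PowerSeries.constantCoeff ξ = 0) :
    expσ (1 / 2 : K) ξ * expσ (1 / 2) ξ = 1 + scalar _ ξ * E K 0 3 := by
  rw [expσ_mul_expσ, ← expσ_one hξ]
  congr 1
  ring

theorem ΦE_eq (ξ : K⟦X⟧) : ΦE ξ =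
    formalExp K (tmul K (scalar _ ξ * E K 0 1) (E K 1 3 * expσ (-1 / 2 : K) ξ)) := by
  rw [ΦE, scalar_mul_tmul]; rfl

theorem ΦE'_eq (ξ : K⟦X⟧) : ΦE' ξ =
    formalExp K (tmul K (scalar _ ξ * -E K 2 3) (E K 0 2 * expσ (-1 / 2 : K) ξ)) := by
  rw [ΦE', scalar_mul_tmul, mul_neg, neg_tmul]; rfl

theorem H14_mul_E14 (ξ : K⟦X⟧) : H K 0 3 * (scalar _ ξ * E K 0 3) =
    scalar _ ξ * E K 0 3 * H K 0 3 + scalar _ ξ * E K 0 3 := by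
  rw [← mul_assoc, ← (commute_scalar ξ (H K 0 3)).eq, mul_assoc,
    H_mul_E_of_weight (1 : K) _ (by norm_num [Fin.ext_iff]), one_smul, mul_add, mul_assoc]

theorem isTwist_ΦJ (hξ : PowerSeries.constantCoeff ξ = 0) : IsTwist (ΦJ ξ) := by
  have h := isTwistOfTwisted_jordanian (K := K) (F := 1) isUnit_one (h := H K 0 3)
    (e := scalar _ ξ * E K 0 3) (constantCoeff_scalar_mul hξ _)
    (by rw [← comulₕ_H]; exact SemiconjBy.one_left _)
    (by rw [← comulₕ_scalar_mul_E]; exact SemiconjBy.one_left _)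
    (H14_mul_E14 ξ) (counitₕ_H _ _) (counitₕ_scalar_mul ξ (counitₕ_E _ _ _))
  have h2 := h.isTwist_mul isTwist_one
  rwa [mul_one] at h2

theorem ΦJ_semiconjBy_comulₕ (hξ : PowerSeries.constantCoeff ξ = 0) {x : (USL4 K)⟦X⟧} (c : K)
    (hx : H K 0 3 * x = x * H K 0 3 + c • x) (hxe : Commute x (E K 0 3))
    (hΔ : comulₕ x = tmul K x 1 + tmul K 1 x) :
    SemiconjBy (ΦJ ξ) (comulₕ x) (tmul K x (expσ c ξ) + tmul K 1 x) :=
  jordanian_semiconjBy_comulₕ c (constantCoeff_scalar_mul hξ _) hx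
    ((commute_scalar ξ x).symm.mul_right hxe) hΔ

theorem ΦJ_semiconjBy_comulₕ_scalar_mul (hξ : PowerSeries.constantCoeff ξ = 0)
    {x : (USL4 K)⟦X⟧} (c : K) (hx : H K 0 3 * x = x * H K 0 3 + c • x)
    (hxe : Commute x (E K 0 3)) (hΔ : comulₕ x = tmul K x 1 + tmul K 1 x) :
    SemiconjBy (ΦJ ξ) (comulₕ (scalar _ ξ * x))
      (tmul K (scalar _ ξ * x) (expσ c ξ) + tmul K 1 (scalar _ ξ * x)) := by
  rw [map_mul, comulₕ_scalar, tmul_scalar_mul, ← scalar_mul_tmul, ← mul_add]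
  exact SemiconjBy.mul_right (commute_scalar ξ (ΦJ ξ)).symm
    (ΦJ_semiconjBy_comulₕ hξ c hx hxe hΔ)

theorem ΦJ_semiconjBy_comulₕ_expσ (hξ : PowerSeries.constantCoeff ξ = 0) (c : K) :
    SemiconjBy (ΦJ ξ) (comulₕ (expσ c ξ)) (tmul K (expσ c ξ) (expσ c ξ)) :=
  jordanian_semiconjBy_comulₕ_exp c (constantCoeff_scalar_mul hξ _) (H14_mul_E14 ξ)
    (comulₕ_scalar_mul_E ξ _ _ _)

/-- Weight `1/2` gives `x ⊗ e^{σ/2} + 1 ⊗ x`; multiplying by the group-like `e^{-σ/2}` moves the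
exponential to the other leg, the form required of `b` in an extension. -/
theorem ΦJ_semiconjBy_comulₕ_mul_expσ (hξ : PowerSeries.constantCoeff ξ = 0)
    {x : (USL4 K)⟦X⟧} (hx : H K 0 3 * x = x * H K 0 3 + (1 / 2 : K) • x)
    (hxe : Commute x (E K 0 3)) (hΔ : comulₕ x = tmul K x 1 + tmul K 1 x) :
    SemiconjBy (ΦJ ξ) (comulₕ (x * expσ (-1 / 2 : K) ξ))
      (tmul K (x * expσ (-1 / 2 : K) ξ) 1 +
        tmul K (expσ (-1 / 2 : K) ξ) (x * expσ (-1 / 2 : K) ξ)) := by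
  have h := (ΦJ_semiconjBy_comulₕ hξ _ hx hxe hΔ).mul_right
    (ΦJ_semiconjBy_comulₕ_expσ hξ (-1 / 2 : K))
  rwa [← map_mul, add_mul, tmul_mul_tmul, tmul_mul_tmul, expσ_half_mul_neg_half, one_mul] at h

theorem scalar_mul_mul_expσ (hξ : PowerSeries.constantCoeff ξ = 0) {x y : (USL4 K)⟦X⟧}
    (hxy : x * y = y * x + E K 0 3) (hx : Commute x (E K 0 3)) :
    scalar _ ξ * x * (y * expσ (-1 / 2 : K) ξ) =
      y * expσ (-1 / 2 : K) ξ * (scalar _ ξ * x) +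
        (expσ (1 / 2 : K) ξ - expσ (-1 / 2 : K) ξ) := by
  -- Substitute `ξE₁₄ = e^{σ/2}e^{σ/2} - 1`.
  have h1 : scalar _ ξ * E K 0 3 * expσ (-1 / 2 : K) ξ =
      expσ (1 / 2 : K) ξ - expσ (-1 / 2 : K) ξ := by
    rw [← sub_eq_of_eq_add' (expσ_half_mul_half (K := K) hξ), sub_mul, one_mul, mul_assoc,
      expσ_half_mul_neg_half, mul_one]
  have hk := (commute_expσ hξ hx (-1 / 2 : K)).eq
  rw [← h1, mul_assoc, ← mul_assoc x, hxy, add_mul, mul_add, mul_assoc y x, hk,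
    (commute_scalar ξ x).eq, ← mul_assoc _ x, (commute_scalar ξ _).eq]
  simp only [mul_assoc]

theorem isTwistOfTwisted_ΦE_factor (hξ : PowerSeries.constantCoeff ξ = 0)
    {F : (USL4 K ⊗[K] USL4 K)⟦X⟧} (hF : IsUnit F) {x y : (USL4 K)⟦X⟧}
    (hxy : x * y = y * x + E K 0 3) (hx : Commute x (E K 0 3)) (hy : Commute y (E K 0 3))
    (hPx : SemiconjBy F (comulₕ (scalar _ ξ * x))
      (tmul K (scalar _ ξ * x) (expσ (1 / 2 : K) ξ) + tmul K 1 (scalar _ ξ * x)))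
    (hPy : SemiconjBy F (comulₕ (y * expσ (-1 / 2 : K) ξ))
      (tmul K (y * expσ (-1 / 2 : K) ξ) 1 +
        tmul K (expσ (-1 / 2 : K) ξ) (y * expσ (-1 / 2 : K) ξ)))
    (hεx : counitₕ K x = 0) (hεy : counitₕ K y = 0) :
    IsTwistOfTwisted F
      (formalExp K (tmul K (scalar _ ξ * x) (y * expσ (-1 / 2 : K) ξ))) := by
  have hcx := commute_expσ hξ hx
  have hcy := commute_expσ hξ hy
  have hcc : ∀ c d : K, Commute (expσ c ξ) (expσ d ξ) := fun c d => by
    rw [Commute, SemiconjBy, expσ_mul_expσ, expσ_mul_expσ, add_comm]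
  exact isTwistOfTwisted_extension hF (constantCoeff_scalar_mul hξ _) hPx hPy
    (scalar_mul_mul_expσ hξ hxy hx)
    ((commute_scalar ξ _).symm.mul_right (hcx _).symm) ((hcy _).symm.mul_right (hcc _ _))
    ((commute_scalar ξ _).symm.mul_right (hcx _).symm) ((hcy _).symm.mul_right (hcc _ _))
    (counitₕ_scalar_mul ξ hεx) (by rw [map_mul, hεy, zero_mul])

theorem isTwistOfTwisted_ΦE (hξ : PowerSeries.constantCoeff ξ = 0) :
    IsTwistOfTwisted (ΦJ ξ) (ΦE ξ) := by
  rw [ΦE_eq]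
  have c1 : Commute (E K 0 1) (E K 0 3) := E_commute_E14 _ (by decide) (by decide)
  have c2 : Commute (E K 1 3) (E K 0 3) := E_commute_E14 _ (by decide) (by decide)
  exact isTwistOfTwisted_ΦE_factor hξ (isTwist_ΦJ hξ).isUnit E12_mul_E24 c1 c2
    (ΦJ_semiconjBy_comulₕ_scalar_mul hξ _ (H_mul_E_of_weight _ _ (by norm_num [Fin.ext_iff])) c1
      (comulₕ_E _ _ _))
    (ΦJ_semiconjBy_comulₕ_mul_expσ hξ (H_mul_E_of_weight _ _ (by norm_num [Fin.ext_iff])) c2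
      (comulₕ_E _ _ _))
    (counitₕ_E _ _ _) (counitₕ_E _ _ _)

theorem ΦE_semiconjBy_of_commute (hξ : PowerSeries.constantCoeff ξ = 0)
    {Z : (USL4 K ⊗[K] USL4 K)⟦X⟧}
    (h : Commute (tmul K (scalar _ ξ * E K 0 1) (E K 1 3 * expσ (-1 / 2 : K) ξ)) Z) :
    SemiconjBy (ΦE ξ) Z Z := by
  rw [ΦE_eq]
  exact formalExp_tmul_semiconjBy_of_commute
    (constantCoeff_tmul_of_left (constantCoeff_scalar_mul hξ _) _) h

theorem ΦE'_semiconjBy_of_commute (hξ : PowerSeries.constantCoeff ξ = 0)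
    {Z : (USL4 K ⊗[K] USL4 K)⟦X⟧}
    (h : Commute (tmul K (scalar _ ξ * -E K 2 3) (E K 0 2 * expσ (-1 / 2 : K) ξ)) Z) :
    SemiconjBy (ΦE' ξ) Z Z := by
  rw [ΦE'_eq]
  exact formalExp_tmul_semiconjBy_of_commute
    (constantCoeff_tmul_of_left (constantCoeff_scalar_mul hξ _) _) h

theorem commute_mul_expσ (hξ : PowerSeries.constantCoeff ξ = 0) {x y : (USL4 K)⟦X⟧}
    (h : Commute x y) (hx : Commute x (E K 0 3)) (c : K) : Commute x (y * expσ c ξ) :=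
  h.mul_right (commute_expσ hξ hx c)

theorem mul_expσ_commute_mul_expσ (hξ : PowerSeries.constantCoeff ξ = 0) {x y : (USL4 K)⟦X⟧}
    (h : Commute x y) (hx : Commute x (E K 0 3)) (hy : Commute y (E K 0 3)) (c d : K) :
    Commute (x * expσ c ξ) (y * expσ d ξ) := by
  refine (commute_mul_expσ hξ h hx d).mul_left ((commute_expσ hξ hy c).symm.mul_right ?_)
  rw [Commute, SemiconjBy, expσ_mul_expσ, expσ_mul_expσ, add_comm]

theorem expσ_commute_mul_expσ (hξ : PowerSeries.constantCoeff ξ = 0) {x : (USL4 K)⟦X⟧}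
    (hx : Commute x (E K 0 3)) (c d : K) : Commute (expσ c ξ) (x * expσ d ξ) := by
  refine (commute_expσ hξ hx c).symm.mul_right ?_
  rw [Commute, SemiconjBy, expσ_mul_expσ, expσ_mul_expσ, add_comm]

theorem isTwistOfTwisted_ΦE' (hξ : PowerSeries.constantCoeff ξ = 0) :
    IsTwistOfTwisted (ΦE ξ * ΦJ ξ) (ΦE' ξ) := by
  have hF := ((isTwistOfTwisted_ΦE hξ).isTwist_mul (isTwist_ΦJ hξ)).isUnit
  have c12 : Commute (E K 0 1) (E K 0 3) := E_commute_E14 _ (by decide) (by decide)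
  have c24 : Commute (E K 1 3) (E K 0 3) := E_commute_E14 _ (by decide) (by decide)
  have c34 : Commute (-E K 2 3) (E K 0 3) :=
    (E_commute_E14 _ (by decide) (by decide)).neg_left
  have c13 : Commute (E K 0 2) (E K 0 3) := E_commute_E14 _ (by decide) (by decide)
  have c12_34 : Commute (E K 0 1) (-E K 2 3) :=
    (E_commute _ _ (by decide) (by decide)).neg_right
  have c24_34 : Commute (E K 1 3) (-E K 2 3) :=
    (E_commute _ _ (by decide) (by decide)).neg_right
  have c12_13 : Commute (E K 0 1) (E K 0 2) := E_commute _ _ (by decide) (by decide)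
  have c24_13 : Commute (E K 1 3) (E K 0 2) := E_commute _ _ (by decide) (by decide)
  have w34 : H K 0 3 * -E K 2 3 = -E K 2 3 * H K 0 3 + (1 / 2 : K) • -E K 2 3 := by
    rw [mul_neg, H_mul_E_of_weight (1 / 2 : K) _ (by norm_num [Fin.ext_iff]), neg_add, neg_mul,
      smul_neg]
  have Δ34 : comulₕ (-E K 2 3) = tmul K (-E K 2 3) 1 + tmul K 1 (-E K 2 3) := by
    rw [map_neg, comulₕ_E, neg_tmul, tmul_neg, neg_add]
  rw [ΦE'_eq]
  refine isTwistOfTwisted_ΦE_factor hξ hF neg_E34_mul_E13 c34 c13 ?_ ?_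
    (by rw [map_neg, counitₕ_E, neg_zero]) (counitₕ_E _ _ _)
  -- `E₁₂` and `E₂₄` commute with `E₃₄`, `E₁₃` and `E₁₄`, so `ΦE` fixes the coproduct already
  -- computed for `ΦJ`.
  · refine SemiconjBy.mul_left (ΦE_semiconjBy_of_commute hξ (Commute.add_right ?_ ?_))
      (ΦJ_semiconjBy_comulₕ_scalar_mul hξ _ w34 c34 Δ34)
    · exact commute_tmul (commute_scalar_mul ξ ξ c12_34) (expσ_commute_mul_expσ hξ c24 _ _).symm
    · exact commute_tmul (Commute.one_right _)
        ((commute_scalar ξ _).symm.mul_right (commute_mul_expσ hξ c24_34.symm c34 _).symm)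
  · refine SemiconjBy.mul_left (ΦE_semiconjBy_of_commute hξ (Commute.add_right ?_ ?_))
      (ΦJ_semiconjBy_comulₕ_mul_expσ hξ
        (H_mul_E_of_weight _ _ (by norm_num [Fin.ext_iff])) c13 (comulₕ_E _ _ _))
    · exact commute_tmul (scalar_mul_commute ξ (commute_mul_expσ hξ c12_13 c12 _))
        (Commute.one_right _)
    · exact commute_tmul (scalar_mul_commute ξ (commute_expσ hξ c12 _))
        (mul_expσ_commute_mul_expσ hξ c24_13 c24 c13 _ _)

theorem isTwist_ΦE'_mul_ΦE_mul_ΦJ (hξ : PowerSeries.constantCoeff ξ = 0) :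
    IsTwist (ΦE' ξ * ΦE ξ * ΦJ ξ) := by
  rw [mul_assoc]
  exact (isTwistOfTwisted_ΦE' hξ).isTwist_mul
    ((isTwistOfTwisted_ΦE hξ).isTwist_mul (isTwist_ΦJ hξ))

theorem weight_mul_expσ (hξ : PowerSeries.constantCoeff ξ = 0) {h x : (USL4 K)⟦X⟧} {c : K}
    (hh : Commute h (E K 0 3)) (hx : h * x = x * h + c • x) (d : K) :
    h * (x * expσ d ξ) = x * expσ d ξ * h + c • (x * expσ d ξ) := by
  rw [← mul_assoc, hx, add_mul, mul_assoc, (commute_expσ hξ hh d).eq, ← mul_assoc, smul_mul_assoc]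

theorem H23_commute_E14 : Commute (H K 1 2) (E K 0 3) := by
  rw [Commute, SemiconjBy, H_mul_E_of_weight (0 : K) _ (by norm_num [Fin.ext_iff]), zero_smul,
    add_zero]

/-- `H₂₃` commutes with `H₁₄` and `E₁₄`. Under it `E₁₂`, `E₃₄` have weight `-1/2` and `E₂₄`, `E₁₃`
have weight `1/2`, so both extension exponents have total weight zero. -/
theorem semiconjBy_comulₕ_H23 (hξ : PowerSeries.constantCoeff ξ = 0) :
    SemiconjBy (ΦE' ξ * ΦE ξ * ΦJ ξ) (comulₕ (H K 1 2))
      (tmul K (H K 1 2) 1 + tmul K 1 (H K 1 2)) := by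
  have hJ := ΦJ_semiconjBy_comulₕ hξ (0 : K) (x := H K 1 2)
    (by rw [zero_smul, add_zero, (H_commute 0 3 1 2).eq]) H23_commute_E14 (comulₕ_H _ _)
  rw [expσ_zero] at hJ
  refine SemiconjBy.mul_left (SemiconjBy.mul_left (ΦE'_semiconjBy_of_commute hξ ?_)
    (ΦE_semiconjBy_of_commute hξ ?_)) hJ
  · refine commute_tmul_of_weight (1 / 2 : K) (weight_scalar_mul ?_)
      (weight_mul_expσ hξ H23_commute_E14
        (H_mul_E_of_weight _ _ (by norm_num [Fin.ext_iff])) _)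
    rw [mul_neg, H_mul_E_of_weight (-(1 / 2) : K) _ (by norm_num [Fin.ext_iff]), neg_add, neg_mul,
      smul_neg]
  · exact commute_tmul_of_weight (1 / 2 : K)
      (weight_scalar_mul (H_mul_E_of_weight _ _ (by norm_num [Fin.ext_iff])))
      (weight_mul_expσ hξ H23_commute_E14
        (H_mul_E_of_weight _ _ (by norm_num [Fin.ext_iff])) _)

end SL4Twists

/-! ### The element `E_B`: primitivity, weight, and independence from `H₂₃`. -/

section Borel

variable {K : Type*} [Field K]

attribute [local instance 100] LieRing.ofAssociativeRing

variable (K) in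
/-- The defining representation of `sl(4)`. -/
def definingRep : USL4 K →ₐ[K] Matrix (Fin 4) (Fin 4) K :=
  UniversalEnvelopingAlgebra.lift K (LieAlgebra.SpecialLinear.sl (Fin 4) K).incl

theorem map_definingRep_genSL4 (x : LieAlgebra.SpecialLinear.sl (Fin 4) K) :
    PowerSeries.map (definingRep K).toRingHom (genSL4 K x) = PowerSeries.C x.val := by
  rw [genSL4, PowerSeries.map_C]
  congr 1
  exact UniversalEnvelopingAlgebra.lift_ι_apply K _ x

variable [CharZero K] {ξ : K⟦X⟧}

/-- Sharing `e^{-σ}` equally writes the correction as a product of the two elements `b` of the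
extension factors, whose twisted coproducts are known. -/
theorem EB_eq (hξ : PowerSeries.constantCoeff ξ = 0) : EB ξ = -E K 1 2 +
    scalar _ ξ * (E K 0 2 * expσ (-1 / 2 : K) ξ * (E K 1 3 * expσ (-1 / 2 : K) ξ)) := by
  have c24 : Commute (E K 1 3) (E K 0 3) := E_commute_E14 _ (by decide) (by decide)
  rw [EB, ← expσ_neg_one, mul_assoc (E K 0 2) (expσ _ ξ), ← mul_assoc (expσ _ ξ),
    ← (commute_expσ hξ c24 _).eq, mul_assoc (E K 1 3) (expσ _ ξ), expσ_mul_expσ, mul_assoc]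
  congr 5
  ring_nf

theorem ΦE_semiconjBy_comulₕ_E23 (hξ : PowerSeries.constantCoeff ξ = 0) :
    SemiconjBy (ΦE ξ) (tmul K (E K 1 2) 1 + tmul K 1 (E K 1 2))
      (tmul K (E K 1 2) 1 + tmul K 1 (E K 1 2) +
        tmul K (scalar _ ξ * E K 0 2) (E K 1 3 * expσ (-1 / 2 : K) ξ)) := by
  have c23 : Commute (E K 1 2) (E K 0 3) := E_commute_E14 _ (by decide) (by decide)
  have c23_24 : Commute (E K 1 2) (E K 1 3) := E_commute _ _ (by decide) (by decide)
  have c12_13 : Commute (E K 0 1) (E K 0 2) := E_commute _ _ (by decide) (by decide)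
  have h : E K 0 1 * E K 1 2 = E K 1 2 * E K 0 1 + E K 0 2 := E_mul_E _ _ _
  rw [ΦE_eq]
  refine formalExp_semiconjBy_add (constantCoeff_tmul_of_left (constantCoeff_scalar_mul hξ _) _)
    ?_ (commute_tmul (commute_scalar_mul ξ ξ c12_13) (Commute.refl _))
  rw [mul_add, add_mul]
  simp only [tmul_mul_tmul, mul_one, one_mul]
  rw [(commute_mul_expσ hξ c23_24 c23 _).eq, mul_assoc, h, mul_add, add_tmul, ← mul_assoc (E K 1 2),
    ← (commute_scalar ξ (E K 1 2)).eq,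
    mul_assoc (scalar _ ξ) (E K 1 2)]
  abel

theorem ΦE'_semiconjBy_comulₕ_E23 (hξ : PowerSeries.constantCoeff ξ = 0) :
    SemiconjBy (ΦE' ξ) (tmul K (E K 1 2) 1 + tmul K 1 (E K 1 2))
      (tmul K (E K 1 2) 1 + tmul K 1 (E K 1 2) +
        tmul K (scalar _ ξ * E K 1 3) (E K 0 2 * expσ (-1 / 2 : K) ξ)) := by
  have c23 : Commute (E K 1 2) (E K 0 3) := E_commute_E14 _ (by decide) (by decide)
  have c23_13 : Commute (E K 1 2) (E K 0 2) := E_commute _ _ (by decide) (by decide)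
  have c34_24 : Commute (-E K 2 3) (E K 1 3) :=
    (E_commute _ _ (by decide) (by decide)).neg_left
  have h0 : E K 1 2 * E K 2 3 = E K 2 3 * E K 1 2 + E K 1 3 := E_mul_E _ _ _
  have h : -E K 2 3 * E K 1 2 = E K 1 2 * -E K 2 3 + E K 1 3 := by
    rw [neg_mul, mul_neg, h0]
    abel
  rw [ΦE'_eq]
  refine formalExp_semiconjBy_add (constantCoeff_tmul_of_left (constantCoeff_scalar_mul hξ _) _)
    ?_ (commute_tmul (commute_scalar_mul ξ ξ c34_24) (Commute.refl _))
  rw [mul_add, add_mul]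
  simp only [tmul_mul_tmul, mul_one, one_mul]
  rw [(commute_mul_expσ hξ c23_13 c23 _).eq, mul_assoc, h, mul_add, add_tmul, ← mul_assoc (E K 1 2),
    ← (commute_scalar ξ (E K 1 2)).eq,
    mul_assoc (scalar _ ξ) (E K 1 2)]
  abel

/-- The term that `ΦE` created from `E₂₃` is not fixed by `ΦE'`: `[-E₃₄, E₁₃] = E₁₄` produces the
term quadratic in `ξ`. -/
theorem ΦE'_semiconjBy_tmul_E13 (hξ : PowerSeries.constantCoeff ξ = 0) :
    SemiconjBy (ΦE' ξ) (tmul K (scalar _ ξ * E K 0 2) (E K 1 3 * expσ (-1 / 2 : K) ξ))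
      (tmul K (scalar _ ξ * E K 0 2) (E K 1 3 * expσ (-1 / 2 : K) ξ) +
        tmul K (scalar _ ξ * (scalar _ ξ * E K 0 3))
          (E K 0 2 * expσ (-1 / 2 : K) ξ * (E K 1 3 * expσ (-1 / 2 : K) ξ))) := by
  have c24 : Commute (E K 1 3) (E K 0 3) := E_commute_E14 _ (by decide) (by decide)
  have c13 : Commute (E K 0 2) (E K 0 3) := E_commute_E14 _ (by decide) (by decide)
  have c34 : Commute (-E K 2 3) (E K 0 3) :=
    (E_commute_E14 _ (by decide) (by decide)).neg_left
  have c24_13 : Commute (E K 1 3) (E K 0 2) := E_commute _ _ (by decide) (by decide)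
  have hB := mul_expσ_commute_mul_expσ hξ c24_13 c24 c13 (-1 / 2 : K) (-1 / 2 : K)
  rw [ΦE'_eq]
  refine formalExp_semiconjBy_add (constantCoeff_tmul_of_left (constantCoeff_scalar_mul hξ _) _)
    ?_ (commute_tmul (commute_scalar_mul ξ ξ ((commute_scalar ξ _).symm.mul_right c34))
      ((Commute.refl _).mul_right hB.symm))
  rw [tmul_mul_tmul, tmul_mul_tmul, hB.eq, ← add_tmul]
  congr 1
  rw [mul_assoc, ← mul_assoc (-E K 2 3), ← (commute_scalar ξ (-E K 2 3)).eq, mul_assoc _ (-E K 2 3),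
    neg_E34_mul_E13, mul_add, mul_add, mul_assoc (scalar _ ξ) (E K 0 2),
    ← mul_assoc (E K 0 2) (scalar _ ξ), ← (commute_scalar ξ (E K 0 2)).eq,
    mul_assoc _ (E K 0 2)]

theorem semiconjBy_comulₕ_E23 (hξ : PowerSeries.constantCoeff ξ = 0) :
    SemiconjBy (ΦE' ξ * ΦE ξ * ΦJ ξ) (comulₕ (E K 1 2))
      (tmul K (E K 1 2) 1 + tmul K 1 (E K 1 2) +
        tmul K (scalar _ ξ * E K 1 3) (E K 0 2 * expσ (-1 / 2 : K) ξ) +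
        (tmul K (scalar _ ξ * E K 0 2) (E K 1 3 * expσ (-1 / 2 : K) ξ) +
          tmul K (scalar _ ξ * (scalar _ ξ * E K 0 3))
            (E K 0 2 * expσ (-1 / 2 : K) ξ * (E K 1 3 * expσ (-1 / 2 : K) ξ)))) := by
  have c23 : Commute (E K 1 2) (E K 0 3) := E_commute_E14 _ (by decide) (by decide)
  have hJ := ΦJ_semiconjBy_comulₕ hξ (0 : K) (x := E K 1 2)
    (H_mul_E_of_weight _ _ (by norm_num [Fin.ext_iff])) c23 (comulₕ_E _ _ _)
  rw [expσ_zero] at hJ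
  exact (((ΦE'_semiconjBy_comulₕ_E23 hξ).add_right (ΦE'_semiconjBy_tmul_E13 hξ)).mul_left
    (ΦE_semiconjBy_comulₕ_E23 hξ)).mul_left hJ

/-- `ΦJ` gives `k' ⊗ b` with `k' = e^{-σ/2}`, the extension by `ΦE` replaces `k'` by `k = e^{σ/2}`,
and `ΦE'` commutes with the result. -/
theorem semiconjBy_comulₕ_E24_mul_expσ (hξ : PowerSeries.constantCoeff ξ = 0) :
    SemiconjBy (ΦE' ξ * ΦE ξ * ΦJ ξ) (comulₕ (E K 1 3 * expσ (-1 / 2 : K) ξ))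
      (tmul K (E K 1 3 * expσ (-1 / 2 : K) ξ) 1 +
        tmul K (expσ (1 / 2 : K) ξ) (E K 1 3 * expσ (-1 / 2 : K) ξ)) := by
  have c12 : Commute (E K 0 1) (E K 0 3) := E_commute_E14 _ (by decide) (by decide)
  have c24 : Commute (E K 1 3) (E K 0 3) := E_commute_E14 _ (by decide) (by decide)
  have c13 : Commute (E K 0 2) (E K 0 3) := E_commute_E14 _ (by decide) (by decide)
  have c34 : Commute (-E K 2 3) (E K 0 3) :=
    (E_commute_E14 _ (by decide) (by decide)).neg_left
  have c34_24 : Commute (-E K 2 3) (E K 1 3) :=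
    (E_commute _ _ (by decide) (by decide)).neg_left
  have c13_24 : Commute (E K 0 2) (E K 1 3) := E_commute _ _ (by decide) (by decide)
  have hJ := ΦJ_semiconjBy_comulₕ_mul_expσ hξ (x := E K 1 3)
    (H_mul_E_of_weight _ _ (by norm_num [Fin.ext_iff])) c24 (comulₕ_E _ _ _)
  have hE := extension_semiconjBy (K := K) (a := scalar _ ξ * E K 0 1)
    (b := E K 1 3 * expσ (-1 / 2 : K) ξ) (constantCoeff_scalar_mul hξ _)
    (scalar_mul_mul_expσ hξ E12_mul_E24 c12)
    (scalar_mul_commute ξ (commute_expσ hξ c12 _)).symm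
    (scalar_mul_commute ξ (commute_expσ hξ c12 _)).symm
  rw [← ΦE_eq] at hE
  refine SemiconjBy.mul_left (SemiconjBy.mul_left
    (ΦE'_semiconjBy_of_commute hξ (Commute.add_right ?_ ?_)) hE) hJ
  · exact commute_tmul (scalar_mul_commute ξ (commute_mul_expσ hξ c34_24 c34 _))
      (Commute.one_right _)
  · exact commute_tmul (scalar_mul_commute ξ (commute_expσ hξ c34 _))
      (mul_expσ_commute_mul_expσ hξ c13_24 c13 c24 _ _)

theorem semiconjBy_comulₕ_E13_mul_expσ (hξ : PowerSeries.constantCoeff ξ = 0) :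
    SemiconjBy (ΦE' ξ * ΦE ξ * ΦJ ξ) (comulₕ (E K 0 2 * expσ (-1 / 2 : K) ξ))
      (tmul K (E K 0 2 * expσ (-1 / 2 : K) ξ) 1 +
        tmul K (expσ (1 / 2 : K) ξ) (E K 0 2 * expσ (-1 / 2 : K) ξ)) := by
  have c12 : Commute (E K 0 1) (E K 0 3) := E_commute_E14 _ (by decide) (by decide)
  have c24 : Commute (E K 1 3) (E K 0 3) := E_commute_E14 _ (by decide) (by decide)
  have c13 : Commute (E K 0 2) (E K 0 3) := E_commute_E14 _ (by decide) (by decide)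
  have c34 : Commute (-E K 2 3) (E K 0 3) :=
    (E_commute_E14 _ (by decide) (by decide)).neg_left
  have c12_13 : Commute (E K 0 1) (E K 0 2) := E_commute _ _ (by decide) (by decide)
  have c24_13 : Commute (E K 1 3) (E K 0 2) := E_commute _ _ (by decide) (by decide)
  have hJ := ΦJ_semiconjBy_comulₕ_mul_expσ hξ (x := E K 0 2)
    (H_mul_E_of_weight _ _ (by norm_num [Fin.ext_iff])) c13 (comulₕ_E _ _ _)
  have hE := extension_semiconjBy (K := K) (a := scalar _ ξ * -E K 2 3)
    (b := E K 0 2 * expσ (-1 / 2 : K) ξ) (constantCoeff_scalar_mul hξ _)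
    (scalar_mul_mul_expσ hξ neg_E34_mul_E13 c34)
    (scalar_mul_commute ξ (commute_expσ hξ c34 _)).symm
    (scalar_mul_commute ξ (commute_expσ hξ c34 _)).symm
  rw [← ΦE'_eq] at hE
  refine SemiconjBy.mul_left (SemiconjBy.mul_left hE
    (ΦE_semiconjBy_of_commute hξ (Commute.add_right ?_ ?_))) hJ
  · exact commute_tmul (scalar_mul_commute ξ (commute_mul_expσ hξ c12_13 c12 _))
      (Commute.one_right _)
  · exact commute_tmul (scalar_mul_commute ξ (commute_expσ hξ c12 _))
      (mul_expσ_commute_mul_expσ hξ c24_13 c24 c13 _ _)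

/-- With `b' = E₁₃e^{-σ/2}`, `b = E₂₄e^{-σ/2}`, `k = e^{σ/2}`, expand `(b' ⊗ 1 + k ⊗ b')(b ⊗ 1 + k ⊗
b)`. As `b'k = E₁₃`, `kb = E₂₄` and `k² = 1 + ξE₁₄`, the nonprimitive terms, times `ξ`, are `ξE₁₃ ⊗
b`, `ξE₂₄ ⊗ b'` and `ξ²E₁₄ ⊗ b'b`: those of the twisted `Δ(E₂₃)`, which enter with the opposite
sign. -/
theorem semiconjBy_comulₕ_EB (hξ : PowerSeries.constantCoeff ξ = 0) :
    SemiconjBy (ΦE' ξ * ΦE ξ * ΦJ ξ) (comulₕ (EB ξ)) (tmul K (EB ξ) 1 + tmul K 1 (EB ξ)) := by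
  have c24 : Commute (E K 1 3) (E K 0 3) := E_commute_E14 _ (by decide) (by decide)
  have hS := (semiconjBy_comulₕ_E23 hξ).neg_right.add_right
    (SemiconjBy.mul_right (commute_scalar ξ (ΦE' ξ * ΦE ξ * ΦJ ξ)).symm
      ((semiconjBy_comulₕ_E13_mul_expσ hξ).mul_right (semiconjBy_comulₕ_E24_mul_expσ hξ)))
  rw [← comulₕ_scalar, ← map_mul, ← map_mul, ← map_neg, ← map_add, ← EB_eq hξ, comulₕ_scalar] at hS
  have h13 : E K 0 2 * expσ (-1 / 2 : K) ξ * expσ (1 / 2 : K) ξ = E K 0 2 := by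
    rw [mul_assoc, expσ_neg_half_mul_half, mul_one]
  have h24 : expσ (1 / 2 : K) ξ * (E K 1 3 * expσ (-1 / 2 : K) ξ) = E K 1 3 := by
    rw [← mul_assoc, ← (commute_expσ hξ c24 _).eq, mul_assoc, expσ_half_mul_neg_half, mul_one]
  refine Eq.mp (congrArg (SemiconjBy _ _) ?_) hS
  rw [EB_eq hξ, mul_add, add_mul, add_mul]
  simp only [tmul_mul_tmul, mul_one, one_mul, h13, h24, expσ_half_mul_half hξ, add_tmul, tmul_add,
    neg_tmul, tmul_neg, ← scalar_mul_tmul, tmul_scalar_mul, mul_add]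
  abel

theorem H23_mul_EB (hξ : PowerSeries.constantCoeff ξ = 0) :
    H K 1 2 * EB ξ = EB ξ * H K 1 2 + EB ξ := by
  have h13 := weight_mul_expσ hξ H23_commute_E14
    (H_mul_E_of_weight (i := 1) (j := 2) (k := 0) (l := 2) (1 / 2 : K) (by decide)
      (by norm_num [Fin.ext_iff])) (-1 / 2)
  have h24 := weight_mul_expσ hξ H23_commute_E14
    (H_mul_E_of_weight (i := 1) (j := 2) (k := 1) (l := 3) (1 / 2 : K) (by decide)
      (by norm_num [Fin.ext_iff])) (-1 / 2)
  have h23 : H K 1 2 * E K 1 2 = E K 1 2 * H K 1 2 + (1 : K) • E K 1 2 :=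
    H_mul_E_of_weight _ _ (by norm_num [Fin.ext_iff])
  rw [one_smul] at h23
  rw [EB_eq hξ]
  generalize E K 0 2 * expσ (-1 / 2 : K) ξ = x at *
  generalize E K 1 3 * expσ (-1 / 2 : K) ξ = y at *
  -- The weights `1/2` of the two factors add up to the weight `1` of `E₂₃`.
  have hxy : H K 1 2 * (x * y) = x * y * H K 1 2 + (1 : K) • (x * y) := by
    rw [← mul_assoc, h13, add_mul, mul_assoc, h24, mul_add, mul_smul_comm, smul_mul_assoc,
      add_assoc, ← add_smul, mul_assoc]
    norm_num
  have hs := weight_scalar_mul (ξ := ξ) hxy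
  rw [one_smul] at hs
  rw [mul_add, add_mul, hs, mul_neg, neg_mul, h23]
  abel

theorem counitₕ_EB (ξ : K⟦X⟧) : counitₕ K (EB ξ) = 0 := by
  rw [EB, map_add, map_neg, counitₕ_E, map_mul, map_mul, map_mul, counitₕ_E, zero_mul, zero_mul,
    mul_zero, neg_zero, zero_add]

theorem map_definingRep_EB (ξ : K⟦X⟧) :
    PowerSeries.map (definingRep K).toRingHom (EB ξ) =
      -PowerSeries.C (Matrix.single 1 2 (1 : K)) := by
  have h : PowerSeries.map (definingRep K).toRingHom (E K 0 2 * E K 1 3) = 0 := by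
    rw [map_mul, E_eq, E_eq, map_definingRep_genSL4, map_definingRep_genSL4, ← map_mul,
      LieAlgebra.SpecialLinear.val_single, LieAlgebra.SpecialLinear.val_single,
      Matrix.single_mul_single_of_ne _ _ _ _ (by decide), map_zero]
  rw [EB, map_add, map_neg, map_mul, map_mul, h, zero_mul, mul_zero, add_zero, E_eq,
    map_definingRep_genSL4]
  rfl

theorem isBorelBasis_H23_EB (hξ : PowerSeries.constantCoeff ξ = 0) :
    IsBorelBasis K (H K 1 2) (EB ξ) where
  lie_eq := by rw [H23_mul_EB hξ, add_sub_cancel_left]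
  linearIndependent := by
    intro a b hab
    have h := congrArg (PowerSeries.map (definingRep K).toRingHom) hab
    rw [map_add, map_mul, map_mul, map_scalar, map_scalar, map_definingRep_EB, H_eq,
      map_definingRep_genSL4, map_zero, LieAlgebra.SpecialLinear.val_singleSubSingle] at h
    have hn : ∀ n i j, (PowerSeries.coeff n a • (Matrix.single 1 1 (1 / 2 : K) -
        Matrix.single 2 2 (1 / 2)) - PowerSeries.coeff n b • Matrix.single 1 2 (1 : K) :
          Matrix (Fin 4) (Fin 4) K) i j = 0 := by
      intro n i j
      have h2 := congrArg (PowerSeries.coeff n) h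
      rw [map_add, mul_neg, map_neg, PowerSeries.coeff_mul_C, PowerSeries.coeff_mul_C, scalar,
        scalar, PowerSeries.coeff_map, PowerSeries.coeff_map, Algebra.algebraMap_eq_smul_one,
        Algebra.algebraMap_eq_smul_one, smul_mul_assoc, smul_mul_assoc, one_mul, one_mul,
        ← sub_eq_add_neg, map_zero] at h2
      rw [h2]
      rfl
    constructor
    -- Row and column `1`, counted from zero, isolate half the coefficient of `a`; the entry `(1,
    -- 2)` isolates that of `b` up to sign.
    · ext n
      simpa [Matrix.single_apply] using hn n 1 1
    · ext n
      simpa [Matrix.single_apply] using hn n 1 2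

end Borel

end JordanianTwist

end

theorem mainTheorem4 {K : Type*} [Field K] [CharZero K] (ξ η : K⟦X⟧)
    (hξ : PowerSeries.constantCoeff ξ = 0) (hη : PowerSeries.constantCoeff η = 0) :
    IsTwist (ΦE' ξ * ΦE ξ * ΦJ ξ) ∧
    IsPrimitiveFor (ΦE' ξ * ΦE ξ * ΦJ ξ) (EB ξ) ∧
    IsPrimitiveFor (ΦE' ξ * ΦE ξ * ΦJ ξ) (H K 1 2) ∧
    IsBorelBasis K (H K 1 2) (EB ξ) ∧
    IsTwistOfTwisted (ΦE' ξ * ΦE ξ * ΦJ ξ) (ΦBJ ξ η) ∧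
    IsTwist (ΦBJ ξ η * ΦE' ξ * ΦE ξ * ΦJ ξ) := by
  have hF := isTwist_ΦE'_mul_ΦE_mul_ΦJ hξ
  have hH := semiconjBy_comulₕ_H23 hξ
  have hE := semiconjBy_comulₕ_EB hξ
  have hG : IsTwistOfTwisted (ΦE' ξ * ΦE ξ * ΦJ ξ) (ΦBJ ξ η) :=
    isTwistOfTwisted_jordanian hF.isUnit (constantCoeff_scalar_mul hη _) hH
      (semiconjBy_comulₕ_scalar_mul η hE)
      (by rw [← mul_assoc, ← (commute_scalar η (H K 1 2)).eq, mul_assoc, H23_mul_EB hξ, mul_add,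
        mul_assoc])
      (counitₕ_H _ _) (counitₕ_scalar_mul η (counitₕ_EB ξ))
  refine ⟨hF, (isPrimitiveFor_iff hF.isUnit).mpr hE, (isPrimitiveFor_iff hF.isUnit).mpr hH,
    isBorelBasis_H23_EB hξ, hG, ?_⟩
  have h := hG.isTwist_mul hF
  rwa [← mul_assoc, ← mul_assoc] at h
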